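/- **Theorem (a-priori guarantees for convex robust storage planning).** *Model.* Consider a transmission network with finite sets of buses $\mathcal N$, generators $\mathcal G$, lines $\mathcal L$ and candidate storage locations $\mathcal S$ (each generator $i$ and location $s$ sits at a bus, and $\mathcal G(n)$, $\mathcal S(n)$ are those at bus $n$; line $l$ goes from $o(l)$ to $r(l)$), and periods $\mathcal T=\{1,\dots,H\}$. All parameters below are real, with $K_d>0$, $x_l\ne 0$ and $\eta^{\rm dis}_s\neq 0$. A scenario is $\delta=(\alpha^w_{n,t},\alpha^d_{n,t})_{n\in\mathcal N,t\in\mathcal T}$. A first-stage decision is $x=(E_s,P_s)_{s\in\mathcal S}\in\mathbb R^{2|\mathcal S|}$; it is feasible, $x\in\Xi_1$, if $$\sum_s (C^E_sE_s+C^P_sP_s)\le C^{\rm budget},\qquad \underline\rho E_s\le P_s\le\overline\rho E_s\quad (s\in\mathcal S).$$ The second-stage set $\Xi_2(x;\delta)$ consists of the real tuples $y=(p^{\rm ch},p^{\rm dis},v,e,p^{\mathcal G},p^{\rm shed},p^{\mathcal L},\theta)$ with, for all indices, $$\sum_{i\in\mathcal G(n)}p^{\mathcal G}_{i,t}+\sum_{s\in\mathcal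 S(n)}(p^{\rm dis}_{s,t}-p^{\rm ch}_{s,t})+\alpha^w_{n,t}\overline{w_n}+\sum_{l:r(l)=n}p^{\mathcal L}_{l,t}-\sum_{l:o(l)=n}p^{\mathcal L}_{l,t}+p^{\rm shed}_{n,t}=\alpha^d_{n,t}\overline{d_n},$$ $$\underline{p_i}\le p^{\mathcal G}_{i,t}\le\overline{p_i},\quad \underline{p_l}\le p^{\mathcal L}_{l,t}\le\overline{p_l},\quad 0\le p^{\rm shed}_{n,t}\le\alpha^d_{n,t}\overline{d_n},\quad p^{\mathcal L}_{l,t}=\tfrac1{x_l}(\theta_{o(l),t}-\theta_{r(l),t}),$$ $$0\le p^{\rm ch}_{s,t}\le P_sv_{s,t},\quad 0\le p^{\rm dis}_{s,t}\le P_s(1-v_{s,t}),\quad 0\le e_{s,t}\le E_s,\quad 0\le v_{s,t}\le1,$$ and, for $t=2,\dots,H$, $$-\underline R_i\le p^{\mathcal G}_{i,t}-p^{\mathcal G}_{i,t-1}\le\overline R_i,\qquad e_{s,t}-e_{s,t-1}=\eta^{\rm ch}_sp^{\rm ch}_{s,t}-p^{\rm dis}_{s,t}/\eta^{\rm dis}_s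 .$$ The costs are either $C(x)=\sum_s(C^E_sE_s+C^P_sP_s)$ and $c(y)=\sum_{t}\big(\sum_i c^{\mathcal G}_ip^{\mathcal G}_{i,t}+\sum_s(c^{\rm ch}_sp^{\rm ch}_{s,t}+c^{\rm dis}_sp^{\rm dis}_{s,t})+\sum_nc^{\rm shed}_np^{\rm shed}_{n,t}\big)$ (cost-minimizing formulation), or $C(x)=0$ and $c(y)=\sum_{t,n}p^{\rm shed}_{n,t}$ (curtailment-minimizing formulation). Given scenarios $\delta^{(1)},\dots,\delta^{(K)}$, the convex robust storage planning problem (c-RSP) is $$\min_{x\in\Xi_1}\ C(x)+K_d\max_{1\le k\le K}\ \min_{y\in\Xi_2(x;\delta^{(k)})}c(y),$$ where the inner minimum is $+\infty$ if $\Xi_2(x;\delta^{(k)})=\emptyset$. Its optimal solutions are the pairs $(x^*,\gamma^*)$ where $x^*$ is a minimizer and $\gamma^*\in\mathbb R$ is the worst-case cost $\max_k\min_{y\in\Xi_2(x^*;\delta^{(k)})}c(y)$. If there are several, one is selected by a tie-break rule: finitely many convex functions $t_1,\dots,t_p$ on $\mathbb R^{2|\mathcal S|}\times\mathbb R$ (possibly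 $p=0$), minimized successively, $t_1$ over the optimal solutions, $t_2$ over the minimizers of $t_1$, and so on. The scenarios are drawn independently from an arbitrary probability distribution $\mathbb P$ of $\delta$, and $$\mathbb V(x,\gamma):=\mathbb P\big(\{\delta:\ \text{there is no } y\in\Xi_2(x;\delta)\text{ with }c(y)\le\gamma\}\big)$$ is the violation probability. *Claim.* Let $\overline\epsilon,\beta\in(0,1)$, and let $K$ be the smallest natural number such that $$\sum_{i=0}^{2|\mathcal S|}\binom Ki\,\overline\epsilon^{\,i}(1-\overline\epsilon)^{K-i}\le\beta .$$ Suppose that, for $\mathbb P^K$-almost every sample of $K$ scenarios, the tie-break rule selects exactly one optimal solution $(x^*,\gamma^*)$ of (c-RSP). Then $$\mathbb P^K\big(\mathbb V(x^*,\gamma^*)\le\overline\epsilon\big)\ \ge\ 1-\beta\qquad\text{and}\qquad \mathbb P^K\big(\mathbb V(x^*,\gamma^*)>\overline\epsilon\big)\ \le\ \beta .$$ -/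

import Mathlib

open MeasureTheory

namespace StoragePlanning

/-- Data of a storage planning problem on a transmission network with buses `Bus`, generators `Gen`,
lines `Line`, candidate storage locations `Site`, and `H` consecutive operating periods. -/
structure Network (Bus Gen Line Site : Type*) (H : ℕ) where
  /-- bus of a generator; the generators at bus `n` are those `i` with `genBus i = n` -/
  genBus : Gen → Bus
  /-- bus of a candidate storage location -/
  siteBus : Site → Bus
  /-- sending bus of a line -/
  sendBus : Line → Bus
  /-- receiving bus of a line -/
  recvBus : Line → Bus
  /-- annualized investment cost per unit of energy capacity -/
  costE : Site → ℝ
  /-- annualized investment cost per unit of power capacity -/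
  costP : Site → ℝ
  /-- investment budget -/
  budget : ℝ
  /-- minimum power/energy ratio -/
  ratioMin : ℝ
  /-- maximum power/energy ratio -/
  ratioMax : ℝ
  /-- weight of the operational cost -/
  weight : ℝ
  weight_pos : 0 < weight
  /-- incremental generation cost -/
  costGen : Gen → ℝ
  /-- incremental charging cost -/
  costCh : Site → ℝ
  /-- incremental discharging cost -/
  costDis : Site → ℝ
  /-- cost of load curtailment -/
  costShed : Bus → ℝ
  /-- charging efficiency -/
  effCh : Site → ℝ
  /-- discharging efficiency -/
  effDis : Site → ℝ
  effDis_ne_zero : ∀ s, effDis s ≠ 0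
  genMin : Gen → ℝ
  genMax : Gen → ℝ
  /-- ramp-down limit -/
  rampDown : Gen → ℝ
  /-- ramp-up limit -/
  rampUp : Gen → ℝ
  lineMin : Line → ℝ
  lineMax : Line → ℝ
  reactance : Line → ℝ
  reactance_ne_zero : ∀ l, reactance l ≠ 0
  /-- maximum wind capacity -/
  windCap : Bus → ℝ
  /-- peak load -/
  peakLoad : Bus → ℝ

/-- The two objectives: cost-minimizing and curtailment-minimizing. -/
inductive Formulation
  | costMin
  | curtailMin

/-- A scenario `δ = (αʷ, αᵈ)`: wind capacity factors and load factors, per bus and period. -/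
abbrev Scenario (Bus : Type*) (H : ℕ) := (Bus → Fin H → ℝ) × (Bus → Fin H → ℝ)

/-- A first-stage decision `x = (E, P)`: energy and power capacities, per candidate location. -/
abbrev Plan (Site : Type*) := (Site → ℝ) × (Site → ℝ)

/-- A second-stage decision. -/
structure Operation (Bus Gen Line Site : Type*) (H : ℕ) where
  /-- charging power -/
  ch : Site → Fin H → ℝ
  /-- discharging power -/
  dis : Site → Fin H → ℝ
  /-- relaxed charging/discharging status -/
  status : Site → Fin H → ℝ
  /-- state of charge -/
  soc : Site → Fin H → ℝ
  /-- generator output -/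
  gen : Gen → Fin H → ℝ
  /-- load curtailment -/
  shed : Bus → Fin H → ℝ
  /-- line flow -/
  flow : Line → Fin H → ℝ
  /-- voltage angle -/
  angle : Bus → Fin H → ℝ

section

variable {Bus Gen Line Site : Type*} [Fintype Bus] [DecidableEq Bus] [Fintype Gen] [Fintype Line]
  [Fintype Site] {H : ℕ}

/-- Total investment cost. -/
def investment (D : Network Bus Gen Line Site H) (x : Plan Site) : ℝ :=
  ∑ s, (D.costE s * x.1 s + D.costP s * x.2 s)

/-- The first-stage objective `C(x)`. -/
def firstCost (D : Network Bus Gen Line Site H) : Formulation → Plan Site → ℝ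
  | .costMin, x => investment D x
  | .curtailMin, _ => 0

/-- The second-stage objective `c(y)`. -/
def secondCost (D : Network Bus Gen Line Site H) :
    Formulation → Operation Bus Gen Line Site H → ℝ
  | .costMin, y =>
      (∑ t, ∑ i, D.costGen i * y.gen i t)
        + (∑ t, ∑ s, (D.costCh s * y.ch s t + D.costDis s * y.dis s t))
        + ∑ t, ∑ n, D.costShed n * y.shed n t
  | .curtailMin, y => ∑ t, ∑ n, y.shed n t

/-- The convexified first-stage feasible set. -/
def firstFeasible (D : Network Bus Gen Line Site H) : Set (Plan Site) :=
  {x | investment D x ≤ D.budget ∧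
    ∀ s, D.ratioMin * x.1 s ≤ x.2 s ∧ x.2 s ≤ D.ratioMax * x.1 s}

/-- The convexified second-stage feasible set. The two constraints that link a period to its
predecessor are imposed on every pair of consecutive periods. -/
structure IsOperation (D : Network Bus Gen Line Site H) (x : Plan Site) (δ : Scenario Bus H)
    (y : Operation Bus Gen Line Site H) : Prop where
  balance : ∀ n t,
    (∑ i with D.genBus i = n, y.gen i t)
      + (∑ s with D.siteBus s = n, y.dis s t) - (∑ s with D.siteBus s = n, y.ch s t)
      + δ.1 n t * D.windCap n
      + (∑ l with D.recvBus l = n, y.flow l t) - (∑ l with D.sendBus l = n, y.flow l t)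
      + y.shed n t = δ.2 n t * D.peakLoad n
  gen_bounds : ∀ i t, D.genMin i ≤ y.gen i t ∧ y.gen i t ≤ D.genMax i
  ramp : ∀ i (t' t : Fin H), t'.val + 1 = t.val →
    -D.rampDown i ≤ y.gen i t - y.gen i t' ∧ y.gen i t - y.gen i t' ≤ D.rampUp i
  line_bounds : ∀ l t, D.lineMin l ≤ y.flow l t ∧ y.flow l t ≤ D.lineMax l
  shed_bounds : ∀ n t, 0 ≤ y.shed n t ∧ y.shed n t ≤ δ.2 n t * D.peakLoad n
  dc_flow : ∀ l t,
    y.flow l t = 1 / D.reactance l * (y.angle (D.sendBus l) t - y.angle (D.recvBus l) t)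
  soc_update : ∀ s (t' t : Fin H), t'.val + 1 = t.val →
    y.soc s t - y.soc s t' = y.ch s t * D.effCh s - y.dis s t / D.effDis s
  ch_bounds : ∀ s t, 0 ≤ y.ch s t ∧ y.ch s t ≤ x.2 s * y.status s t
  dis_bounds : ∀ s t, 0 ≤ y.dis s t ∧ y.dis s t ≤ x.2 s * (1 - y.status s t)
  soc_bounds : ∀ s t, 0 ≤ y.soc s t ∧ y.soc s t ≤ x.1 s
  status_bounds : ∀ s t, 0 ≤ y.status s t ∧ y.status s t ≤ 1

/-- Optimal value of the second stage, `+∞` if the second stage is infeasible. -/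
noncomputable def recourse (D : Network Bus Gen Line Site H) (f : Formulation) (x : Plan Site)
    (δ : Scenario Bus H) : EReal :=
  ⨅ (y : Operation Bus Gen Line Site H) (_ : IsOperation D x δ y), (secondCost D f y : EReal)

/-- Worst-case second-stage cost over the scenarios `ω 0, …, ω (K - 1)`. -/
noncomputable def worstRecourse (D : Network Bus Gen Line Site H) (f : Formulation) {K : ℕ}
    (ω : Fin K → Scenario Bus H) (x : Plan Site) : EReal :=
  ⨆ k, recourse D f x (ω k)

/-- Objective of the two-stage robust problem with the scenarios `ω`. -/
noncomputable def robustCost (D : Network Bus Gen Line Site H) (f : Formulation) {K : ℕ}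
    (ω : Fin K → Scenario Bus H) (x : Plan Site) : EReal :=
  (firstCost D f x : EReal) + (D.weight : EReal) * worstRecourse D f ω x

/-- The optimal solutions `(x, γ)` of the convex robust storage planning problem with the
scenarios `ω`: the plan `x` minimizes the two-stage objective over the first-stage feasible set,
and the real number `γ` is its worst-case operational cost (so `x` has finite objective). -/
def optimalSolutions (D : Network Bus Gen Line Site H) (f : Formulation) {K : ℕ}
    (ω : Fin K → Scenario Bus H) : Set (Plan Site × ℝ) :=
  {z | z.1 ∈ firstFeasible D ∧ (∀ x ∈ firstFeasible D, robustCost D f ω z.1 ≤ robustCost D f ω x) ∧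
    (z.2 : EReal) = worstRecourse D f ω z.1}

/-- The set `𝒵(δ)` of pairs `(x, γ)` for which scenario `δ` can be operated at cost at most `γ`. -/
def acceptable (D : Network Bus Gen Line Site H) (f : Formulation) (δ : Scenario Bus H) :
    Set (Plan Site × ℝ) :=
  {z | ∃ y, IsOperation D z.1 δ y ∧ secondCost D f y ≤ z.2}

/-- The violation probability `𝕍(x, γ)`. -/
noncomputable def violation (D : Network Bus Gen Line Site H) (f : Formulation)
    (μ : Measure (Scenario Bus H)) (z : Plan Site × ℝ) : ℝ :=
  μ.real {δ | z ∉ acceptable D f δ}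

end

/-- The points of `A` selected by minimizing the first function of the list over `A`, then the
second one over the minimizers of the first, and so on. -/
def tieBreak {α : Type*} : List (α → ℝ) → Set α → Set α
  | [], A => A
  | t :: ts, A => tieBreak ts {z ∈ A | ∀ w ∈ A, t z ≤ t w}

end StoragePlanning

/-!
The problem is first put in epigraph form: `(x, γ)` minimizes the linear function
`C(x) + K_d γ` over the intersection of the sets `scenarioSet D f (δ k)`, followed by the tie-break
functions. These sets are convex, because eliminating the relaxed charging status turns the bilinear
capacity constraints into `ch + dis ≤ P` (`IsDispatch`), and they depend on the scenario through a
closed relation, because all second-stage variables but the angles are bounded. In particular the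
second-stage minimum is attained, and the selected solution is an a.e. measurable function of the
sample (`aemeasurable_of_tieBreak`). The space of pairs `(x, γ)` has dimension `d = 2|S| + 1`.

What remains is the binomial tail bound of scenario optimization (`measureReal_lt_violation_le`),
which has to be proved with existence and uniqueness of the solution assumed for samples of the one
size `K` only, and without any nondegeneracy. Draw `K + m` scenarios, and consider the solutions of
all subsamples of size `K`, each with the number of the `K + m` scenarios that violate it. For a
fixed sample of `K + m` scenarios, at most
`∑ i < d, (r + d).choose i * (m + K - (r + d)).choose (K - i)` subsamples have a solution violated by
more than `r` scenarios (`card_subsample_violated_le`). If the solution of a subsample has violation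
probability above `ε`, then by Chebyshev's inequality more than `r = ⌊ε' m⌋` of the other `m`
scenarios violate it with probability close to `1`, for any `ε' < ε`. Averaging over the subsamples,
letting `m → ∞` and then `ε' → ε` gives the binomial tail.

The counting bound is deterministic. For finitely many convex sets, the successive minimization may
be replaced by that of one strictly convex function (`exists_strictConvexOn_isMinOn_mem`), and the
sets by small generic enlargements (`exists_generic_relaxation`), in such a way that no violation is
lost. By Helly's theorem the minimizer over the constraints in a set `A` is determined by at most `d`
of them, and genericity makes the minimal such set `J` unique. So the family of all index sets is
partitioned into intervals `[J, Vᶜ]` with `#J ≤ d`, where `V` is the set of violated constraints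
(`exists_interval_partition`). Weighting the sets by a suitable function of their cardinality, every
such interval weighs at least as much as it has `K`-element sets if `#V > r`, and at least `0`
otherwise, whereas the total weight is the stated bound (`card_filter_lt_card_le`).
-/

namespace StoragePlanning

/-! ### Scalarization of successive minimization -/

section Geometry

open Filter Topology

theorem tieBreak_subset {α : Type*} (ts : List (α → ℝ)) (A : Set α) : tieBreak ts A ⊆ A := by
  induction ts generalizing A with
  | nil => exact subset_rfl
  | cons t ts ih => exact (ih _).trans (Set.sep_subset _ _)

/-- A uniquely selected point is still the selected one among fewer candidates. -/
theorem tieBreak_eq_singleton_of_subset {α : Type*} {ts : List (α → ℝ)} {A B : Set α} {z : α}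
    (hA : tieBreak ts A = {z}) (hBA : B ⊆ A) (hz : z ∈ B) : tieBreak ts B = {z} := by
  induction ts generalizing A B with
  | nil =>
    have hA' : A = {z} := hA
    subst hA'
    exact Set.Subset.antisymm hBA (Set.singleton_subset_iff.2 hz)
  | cons t ts ih =>
    have hzA : z ∈ {x ∈ A | ∀ w ∈ A, t x ≤ t w} :=
      tieBreak_subset ts _ (by rw [show tieBreak ts _ = {z} from hA]; rfl)
    refine ih (A := {x ∈ A | ∀ w ∈ A, t x ≤ t w}) hA (fun x hx => ?_)
      ⟨hz, fun w hw => hzA.2 w (hBA hw)⟩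
    exact ⟨hBA hx.1, fun w hw => (hx.2 z hz).trans (hzA.2 w hw)⟩

/-- For small positive weights `η`, the minimizers of `t + η F` on a compact set are close to the
minimizers of `F` among the minimizers of `t`. -/
theorem eventually_forall_isMinOn_mem {E : Type*} [PseudoMetricSpace E] {S O : Set E}
    {t F : E → ℝ} (hS : IsCompact S) (ht : Continuous t) (hF : Continuous F) (hO : IsOpen O)
    (h : ∀ x ∈ {z ∈ S | ∀ w ∈ S, t z ≤ t w},
      IsMinOn F {z ∈ S | ∀ w ∈ S, t z ≤ t w} x → x ∈ O) :
    ∀ᶠ η in 𝓝[>] (0 : ℝ), ∀ x ∈ S, IsMinOn (fun y => t y + η * F y) S x → x ∈ O := by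
  by_contra hcon
  rw [not_eventually] at hcon
  obtain ⟨η, hη, hbad⟩ := exists_seq_forall_of_frequently hcon
  have hη0 : Tendsto η atTop (𝓝 0) := hη.mono_right nhdsWithin_le_nhds
  have hpos : ∀ᶠ n in atTop, 0 < η n := hη.eventually self_mem_nhdsWithin
  push Not at hbad
  choose x hxS hxmin hxO using hbad
  obtain ⟨y, hy, φ, hφ, hlim⟩ := hS.tendsto_subseq hxS
  have hη' : Tendsto (fun n => η (φ n)) atTop (𝓝 0) := hη0.comp hφ.tendsto_atTop
  have hty : Tendsto (fun n => t (x (φ n))) atTop (𝓝 (t y)) := (ht.tendsto y).comp hlim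
  have hFy : Tendsto (fun n => F (x (φ n))) atTop (𝓝 (F y)) := (hF.tendsto y).comp hlim
  have hyt : ∀ w ∈ S, t y ≤ t w := by
    intro w hw
    have h1 : Tendsto (fun n => t (x (φ n)) + η (φ n) * F (x (φ n))) atTop (𝓝 (t y + 0 * F y)) :=
      hty.add (hη'.mul hFy)
    have h2 : Tendsto (fun n => t w + η (φ n) * F w) atTop (𝓝 (t w + 0 * F w)) :=
      tendsto_const_nhds.add (hη'.mul_const _)
    have := le_of_tendsto_of_tendsto' h1 h2 fun n => isMinOn_iff.1 (hxmin (φ n)) w hw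
    simpa using this
  have hyO : y ∈ O := by
    refine h y ⟨hy, hyt⟩ (isMinOn_iff.2 fun w hw => ?_)
    refine le_of_tendsto hFy ?_
    filter_upwards [hφ.tendsto_atTop.eventually hpos] with n hn
    have h1 := isMinOn_iff.1 (hxmin (φ n)) w hw.1
    have h2 := hw.2 _ (hxS (φ n))
    exact le_of_mul_le_mul_left (by linarith) hn
  obtain ⟨n, hn⟩ := (hlim.eventually (hO.mem_nhds hyO)).exists
  exact hxO _ hn

theorem convexOn_infDist {E : Type*} [SeminormedAddCommGroup E] [NormedSpace ℝ E] {C : Set E}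
    (hC : Convex ℝ C) (hne : C.Nonempty) :
    ConvexOn ℝ Set.univ (fun x => Metric.infDist x C) := by
  refine ⟨convex_univ, fun x _ y _ a b ha hb hab => ?_⟩
  refine le_of_forall_pos_le_add fun ε hε => ?_
  obtain ⟨p, hp, hxp⟩ := (Metric.infDist_lt_iff hne).1 (lt_add_of_pos_right (Metric.infDist x C) hε)
  obtain ⟨q, hq, hyq⟩ := (Metric.infDist_lt_iff hne).1 (lt_add_of_pos_right (Metric.infDist y C) hε)
  refine (Metric.infDist_le_dist_of_mem (hC hp hq ha hb hab)).trans ?_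
  calc dist (a • x + b • y) (a • p + b • q)
      ≤ dist (a • x) (a • p) + dist (b • y) (b • q) := dist_add_add_le _ _ _ _
    _ = a * dist x p + b * dist y q := by
        rw [dist_smul₀, dist_smul₀, Real.norm_of_nonneg ha, Real.norm_of_nonneg hb]
    _ ≤ a * (Metric.infDist x C + ε) + b * (Metric.infDist y C + ε) := by gcongr
    _ = _ := by simp only [smul_eq_mul]; linear_combination ε * hab

variable {E : Type*} [NormedAddCommGroup E] [NormedSpace ℝ E] [FiniteDimensional ℝ E]

theorem continuous_of_convexOn_univ {t : E → ℝ} (ht : ConvexOn ℝ Set.univ t) : Continuous t :=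
  ht.locallyLipschitz.continuous

theorem exists_strictConvexOn_univ (E : Type*) [NormedAddCommGroup E] [NormedSpace ℝ E]
    [FiniteDimensional ℝ E] : ∃ q : E → ℝ, StrictConvexOn ℝ Set.univ q := by
  refine ⟨fun x => ‖toEuclidean x‖ ^ 2, ?_⟩
  have hsq : StrictConvexOn ℝ Set.univ
      (fun x : EuclideanSpace ℝ (Fin (Module.finrank ℝ E)) => ‖x‖ ^ 2) := by
    refine StrongConvexOn.strictConvexOn (m := 2) ?_ two_pos
    rw [strongConvexOn_iff_convex]
    simpa using convexOn_const (0 : ℝ) convex_univ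
  refine ⟨convex_univ, fun x _ y _ hxy a b ha hb hab => ?_⟩
  have := hsq.2 (Set.mem_univ (toEuclidean x)) (Set.mem_univ (toEuclidean y))
    (fun h => hxy (toEuclidean.injective h)) ha hb hab
  simpa using this

/-- Successive minimization over finitely many compact sets can be approximated by minimization of
one strictly convex function: its minimizers lie in prescribed neighbourhoods of the points
selected by the tie-break rule. -/
theorem exists_strictConvexOn_isMinOn_mem {ι : Type*} [Finite ι] {ts : List (E → ℝ)}
    (hts : ∀ t ∈ ts, ConvexOn ℝ Set.univ t) {S O : ι → Set E} {z : ι → E}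
    (hS : ∀ a, IsCompact (S a)) (hO : ∀ a, IsOpen (O a))
    (hz : ∀ a, tieBreak ts (S a) = {z a}) (hzO : ∀ a, z a ∈ O a) :
    ∃ F : E → ℝ, StrictConvexOn ℝ Set.univ F ∧
      ∀ a, ∀ x ∈ S a, IsMinOn F (S a) x → x ∈ O a := by
  induction ts generalizing S with
  | nil =>
    obtain ⟨q, hq⟩ := exists_strictConvexOn_univ E
    refine ⟨q, hq, fun a x hx _ => ?_⟩
    have : S a = {z a} := hz a
    rw [this, Set.mem_singleton_iff] at hx
    exact hx ▸ hzO a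
  | cons t ts ih =>
    have ht : ConvexOn ℝ Set.univ t := hts t (by simp)
    have htc := continuous_of_convexOn_univ ht
    obtain ⟨F, hF, hFO⟩ := ih (fun s hs => hts s (by simp [hs]))
      (S := fun a => {x ∈ S a | ∀ w ∈ S a, t x ≤ t w}) (fun a => by
        refine (hS a).of_isClosed_subset ?_ (Set.sep_subset _ _)
        refine (hS a).isClosed.inter (isClosed_iff_frequently.2 fun x hx => ?_)
        intro w hw
        have : IsClosed {x | t x ≤ t w} := isClosed_le htc continuous_const
        exact this.closure_subset (mem_closure_iff_frequently.2 (hx.mono fun y hy => hy w hw)))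
      (fun a => hz a)
    have hev : ∀ᶠ η in 𝓝[>] (0 : ℝ), ∀ a, ∀ x ∈ S a,
        IsMinOn (fun y => t y + η * F y) (S a) x → x ∈ O a :=
      eventually_all.2 fun a => eventually_forall_isMinOn_mem (hS a) htc
        (continuous_of_convexOn_univ hF.convexOn) (hO a) (hFO a)
    obtain ⟨η, hη, hη0⟩ := (hev.and self_mem_nhdsWithin).exists
    refine ⟨fun y => t y + η * F y, ht.add_strictConvexOn ⟨convex_univ, ?_⟩, hη⟩
    intro x hx y hy hxy a b ha hb hab
    have := hF.2 hx hy hxy ha hb hab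
    simp only [smul_eq_mul] at this ⊢
    have := mul_lt_mul_of_pos_left this (Set.mem_Ioi.1 hη0)
    linarith

end Geometry

/-! ### Generic relaxation of convex constraints -/

section Perturbation

open Filter Topology

/-- The points of `X` at which each constraint function `g i` with `i ∈ A` is at most `u i`. -/
def relaxed {ι E : Type*} (X : Set E) (g : ι → E → ℝ) (u : ι → ℝ) (A : Finset ι) : Set E :=
  {x ∈ X | ∀ i ∈ A, g i x ≤ u i}

theorem relaxed_anti {ι E : Type*} (X : Set E) (g : ι → E → ℝ) (u : ι → ℝ) {A B : Finset ι}
    (h : A ⊆ B) : relaxed X g u B ⊆ relaxed X g u A :=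
  fun _ hx => ⟨hx.1, fun i hi => hx.2 i (h hi)⟩

theorem isCompact_relaxed {ι E : Type*} [TopologicalSpace E] {X : Set E} {g : ι → E → ℝ}
    (hX : IsCompact X) (hg : ∀ i, Continuous (g i)) (u : ι → ℝ) (A : Finset ι) :
    IsCompact (relaxed X g u A) := by
  have : relaxed X g u A = X ∩ ⋂ i ∈ A, {x | g i x ≤ u i} := by
    ext x; simp [relaxed]
  rw [this]
  exact hX.inter_right (isClosed_biInter fun i _ => isClosed_le (hg i) continuous_const)

theorem convex_relaxed {ι E : Type*} [AddCommGroup E] [Module ℝ E] {X : Set E} {g : ι → E → ℝ}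
    (hX : Convex ℝ X) (hg : ∀ i, ConvexOn ℝ Set.univ (g i)) (u : ι → ℝ) (A : Finset ι) :
    Convex ℝ (relaxed X g u A) := by
  have : relaxed X g u A = X ∩ ⋂ i ∈ A, {x | g i x ≤ u i} := by
    ext x; simp [relaxed]
  rw [this]
  refine hX.inter (convex_iInter fun i => convex_iInter fun _ => ?_)
  simpa using (hg i).convex_le (u i)

/-- A constraint violated by every minimizer stays violated when all the constraints are relaxed by
sufficiently small amounts. -/
theorem eventually_forall_lt_of_isMinOn_relaxed {ι E : Type*} [PseudoMetricSpace E] {X : Set E}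
    {F : E → ℝ} {g : ι → E → ℝ} (hX : IsCompact X) (hF : Continuous F)
    (hg : ∀ i, Continuous (g i)) (A : Finset ι) (i : ι)
    (h : ∀ x ∈ relaxed X g 0 A, IsMinOn F (relaxed X g 0 A) x → 0 < g i x) :
    ∀ᶠ ρ in 𝓝[>] (0 : ℝ), ∀ u : ι → ℝ, (∀ j, 0 ≤ u j) → (∀ j, u j ≤ ρ) →
      ∀ x ∈ relaxed X g u A, IsMinOn F (relaxed X g u A) x → u i < g i x := by
  by_contra hcon
  rw [not_eventually] at hcon
  obtain ⟨ρ, hρ, hbad⟩ := exists_seq_forall_of_frequently hcon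
  have hρ0 : Tendsto ρ atTop (𝓝 0) := hρ.mono_right nhdsWithin_le_nhds
  push Not at hbad
  choose u hu0 huρ x hx hmin hle using hbad
  obtain ⟨y, hy, φ, hφ, hlim⟩ := hX.tendsto_subseq fun n => (hx n).1
  have hρ' : Tendsto (fun n => ρ (φ n)) atTop (𝓝 0) := hρ0.comp hφ.tendsto_atTop
  have hgy : ∀ j, Tendsto (fun n => g j (x (φ n))) atTop (𝓝 (g j y)) :=
    fun j => ((hg j).tendsto y).comp hlim
  have hyA : y ∈ relaxed X g 0 A :=
    ⟨hy, fun j hj => le_of_tendsto_of_tendsto' (hgy j) hρ' fun n =>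
      ((hx (φ n)).2 j hj).trans (huρ _ _)⟩
  refine (h y hyA (isMinOn_iff.2 fun w hw => ?_)).not_ge
    (le_of_tendsto_of_tendsto' (hgy i) hρ' fun n => (hle (φ n)).trans (huρ _ _))
  refine le_of_tendsto' ((hF.tendsto y).comp hlim) fun n => isMinOn_iff.1 (hmin (φ n)) w ?_
  exact ⟨hw.1, fun j hj => (hw.2 j hj).trans (hu0 _ _)⟩

/-- A constraint that is slack at the minimizer is redundant: dropping it does not lower the optimal
value. -/
theorem le_of_isMinOn_relaxed_of_lt {ι E : Type*} [DecidableEq ι] [AddCommGroup E] [Module ℝ E]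
    {X : Set E} {F : E → ℝ} {g : ι → E → ℝ} (hX : Convex ℝ X) (hF : ConvexOn ℝ Set.univ F)
    (hg : ∀ i, ConvexOn ℝ Set.univ (g i)) {u : ι → ℝ} {A : Finset ι} {i : ι} {x w : E}
    (hx : x ∈ relaxed X g u A) (hmin : IsMinOn F (relaxed X g u A) x) (hlt : g i x < u i)
    (hw : w ∈ relaxed X g u (A.erase i)) : F x ≤ F w := by
  by_contra! hcon
  obtain ⟨t, ht0, ht1, ht⟩ : ∃ t : ℝ, 0 < t ∧ t ≤ 1 ∧ (1 - t) * g i x + t * g i w ≤ u i := by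
    rcases le_or_gt (g i w) (u i) with h | h
    · exact ⟨1, one_pos, le_rfl, by simpa using h⟩
    · have hpos : 0 < g i w - g i x := by linarith
      refine ⟨(u i - g i x) / (g i w - g i x), div_pos (by linarith) hpos,
        (div_le_one hpos).2 (by linarith), le_of_eq ?_⟩
      field_simp
      ring
  have ht' : 0 ≤ 1 - t := by linarith
  have hcx := convex_relaxed hX hg u (A.erase i)
    (relaxed_anti X g u (A.erase_subset i) hx) hw ht' ht0.le (by ring)
  have hy : (1 - t) • x + t • w ∈ relaxed X g u A := by
    refine ⟨hcx.1, fun j hj => ?_⟩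
    by_cases hji : j = i
    · subst hji
      exact ((hg j).2 (Set.mem_univ x) (Set.mem_univ w) ht' ht0.le (by ring)).trans ht
    · exact hcx.2 j (Finset.mem_erase.2 ⟨hji, hj⟩)
  have h1 := isMinOn_iff.1 hmin _ hy
  have h2 := hF.2 (Set.mem_univ x) (Set.mem_univ w) ht' ht0.le (by ring)
  simp only [smul_eq_mul] at h2
  nlinarith

/-- A finite grid cannot be covered by few sets, each of which is met at most once by every line in
some coordinate direction. -/
theorem exists_forall_not_of_line_subsingleton {ι T : Type*} [Fintype ι] [DecidableEq ι] [Fintype T]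
    {M : ℕ} (hM : Fintype.card T < M) (dir : T → ι) (bad : T → (ι → Fin M) → Prop)
    (h : ∀ τ v v', bad τ v → bad τ v' → (∀ j, j ≠ dir τ → v j = v' j) → v = v') :
    ∃ v, ∀ τ, ¬ bad τ v := by
  classical
  by_contra! hcon
  have hcov : (Finset.univ : Finset (ι → Fin M)) ⊆
      Finset.univ.biUnion fun τ => Finset.univ.filter (bad τ) := by
    intro v _
    obtain ⟨τ, hτ⟩ := hcon v
    simpa using ⟨τ, hτ⟩
  have hfib : ∀ τ ∈ (Finset.univ : Finset T),
      (Finset.univ.filter (bad τ)).card ≤ M ^ (Fintype.card ι - 1) := by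
    intro τ _
    have : (Finset.univ.filter (bad τ)).card ≤
        (Finset.univ : Finset ({j // j ≠ dir τ} → Fin M)).card := by
      refine Finset.card_le_card_of_injOn (fun v j => v j) 
        (fun _ _ => Finset.mem_coe.2 (Finset.mem_univ _)) ?_
      intro v hv v' hv' hvv'
      refine h τ v v' (by simpa using hv) (by simpa using hv') fun j hj => ?_
      exact congrFun hvv' ⟨j, hj⟩
    refine this.trans (le_of_eq ?_)
    simp [Fintype.card_subtype_compl]
  have hle := (Finset.card_le_card hcov).trans (Finset.card_biUnion_le_card_mul _ _ _ hfib)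
  simp only [Finset.card_univ, Fintype.card_fun, Fintype.card_fin] at hle
  rcases Nat.eq_zero_or_pos (Fintype.card ι) with h0 | h0
  · obtain ⟨τ, -⟩ := hcon fun _ => ⟨0, by omega⟩
    exact (Fintype.card_eq_zero_iff.1 h0).elim (dir τ)
  · obtain ⟨n, hn⟩ : ∃ n, Fintype.card ι = n + 1 := ⟨_, (Nat.succ_pred_eq_of_pos h0).symm⟩
    rw [hn, pow_succ, Nat.add_sub_cancel, mul_comm] at hle
    have := Nat.le_of_mul_le_mul_right hle (pow_pos (by omega) n)
    omega

variable {E : Type*} [NormedAddCommGroup E] [NormedSpace ℝ E] [FiniteDimensional ℝ E]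

/-- For suitable arbitrarily small relaxations `u`, if two sets of constraints have the same optimal
value, then a constraint in only one of them is inessential there. Indeed, if `i ∈ A` is essential
and `i ∉ B`, then the optimal values can agree for at most one value of `u i`, the other ones being
fixed. -/
theorem exists_generic_relaxation {ι : Type*} [Fintype ι] [DecidableEq ι] {X : Set E} {F : E → ℝ}
    {g : ι → E → ℝ} (hX : Convex ℝ X) (hXc : IsCompact X)
    (hF : StrictConvexOn ℝ Set.univ F) (hg : ∀ i, ConvexOn ℝ Set.univ (g i))
    (hne : (relaxed X g 0 Finset.univ).Nonempty) {ρ : ℝ} (hρ : 0 < ρ) :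
    ∃ u : ι → ℝ, (∀ i, 0 ≤ u i) ∧ (∀ i, u i ≤ ρ) ∧ ∃ z : Finset ι → E,
      (∀ A, z A ∈ relaxed X g u A ∧ IsMinOn F (relaxed X g u A) (z A)) ∧
      ∀ A B : Finset ι, ∀ i ∈ A, i ∉ B → F (z A) = F (z B) → F (z A) ≤ F (z (A.erase i)) := by
  classical
  have hgc : ∀ i, Continuous (g i) := fun i => continuous_of_convexOn_univ (hg i)
  have hFc := continuous_of_convexOn_univ hF.convexOn
  set M := Fintype.card (Finset ι × Finset ι × ι) + 1 with hM
  have hM0 : (0 : ℝ) < M := by rw [hM]; positivity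
  set u : (ι → Fin M) → ι → ℝ := fun v i => ρ * ((v i : ℕ) / M) with hu
  have hu0 : ∀ v i, 0 ≤ u v i := fun v i => by positivity
  have huρ : ∀ v i, u v i ≤ ρ := fun v i => by
    refine mul_le_of_le_one_right hρ.le ((div_le_one hM0).2 ?_)
    exact_mod_cast (v i).2.le
  have hex : ∀ v A, ∃ x ∈ relaxed X g (u v) A, IsMinOn F (relaxed X g (u v) A) x := fun v A => by
    refine (isCompact_relaxed hXc hgc (u v) A).exists_isMinOn ?_ hFc.continuousOn
    obtain ⟨x, hx⟩ := hne
    exact ⟨x, hx.1, fun i _ => (hx.2 i (Finset.mem_univ i)).trans (hu0 v i)⟩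
  choose z hz hzmin using hex
  obtain ⟨v, hv⟩ := exists_forall_not_of_line_subsingleton
    (T := Finset ι × Finset ι × ι) (M := M) (Nat.lt_succ_self _) (fun τ => τ.2.2)
    (fun τ v => τ.2.2 ∈ τ.1 ∧ τ.2.2 ∉ τ.2.1 ∧ F (z v τ.1) = F (z v τ.2.1) ∧
      F (z v (τ.1.erase τ.2.2)) < F (z v τ.1)) (by
    rintro ⟨A, B, i⟩ v v' ⟨hiA, hiB, hAB, hlt⟩ ⟨-, -, hAB', hlt'⟩ hvv'
    simp only at hiA hiB hAB hlt hAB' hlt' hvv'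
    -- The two grid points play symmetric roles.
    wlog hle : v i ≤ v' i generalizing v v'
    · exact (this v' v hAB' hlt' hAB hlt (fun j hj => (hvv' j hj).symm) (le_of_not_ge hle)).symm
    by_contra hneq
    have hlti : v i < v' i := lt_of_le_of_ne hle fun h => hneq (by
      ext1 j
      by_cases hj : j = i
      · exact hj ▸ h
      · exact hvv' j hj)
    have huu : ∀ j, j ≠ i → u v j = u v' j := fun j hj => by simp only [hu, hvv' j hj]
    have hui : u v i < u v' i := by
      refine mul_lt_mul_of_pos_left (div_lt_div_of_pos_right ?_ hM0) hρ
      exact_mod_cast hlti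
    have hrel : ∀ C : Finset ι, i ∉ C → relaxed X g (u v) C = relaxed X g (u v') C := by
      intro C hC
      ext x
      refine and_congr_right fun _ => forall₂_congr fun j hj => ?_
      rw [huu j (fun h => hC (h ▸ hj))]
    have hB : F (z v B) = F (z v' B) := by
      have h1 := hzmin v B; have h2 := hz v B
      rw [hrel B hiB] at h1 h2
      exact le_antisymm (isMinOn_iff.1 h1 _ (hz v' B)) (isMinOn_iff.1 (hzmin v' B) _ h2)
    have hmem : z v A ∈ relaxed X g (u v') A := by
      refine ⟨(hz v A).1, fun j hj => ((hz v A).2 j hj).trans ?_⟩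
      by_cases hji : j = i
      · exact hji ▸ hui.le
      · exact (huu j hji).le
    have hFA : F (z v A) = F (z v' A) := by rw [hAB, hB, hAB']
    have hmin : IsMinOn F (relaxed X g (u v') A) (z v A) :=
      isMinOn_iff.2 fun w hw => hFA.le.trans (isMinOn_iff.1 (hzmin v' A) w hw)
    have := le_of_isMinOn_relaxed_of_lt hX hF.convexOn hg hmem hmin
      (((hz v A).2 i hiA).trans_lt hui) (hz v' (A.erase i))
    linarith)
  refine ⟨u v, hu0 v, huρ v, z v, fun A => ⟨hz v A, hzmin v A⟩, fun A B i hiA hiB hAB => ?_⟩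
  by_contra! hlt
  exact hv (A, B, i) ⟨hiA, hiB, hAB, hlt⟩

end Perturbation

/-! ### Partition of the index sets into intervals -/

section Partition

open Filter Topology

variable {E : Type*} [NormedAddCommGroup E] [NormedSpace ℝ E] [FiniteDimensional ℝ E]

/-- By Helly's theorem, at most `dim E` of the constraints determine the optimal value. -/
theorem exists_subset_card_le_finrank_le {ι : Type*} [DecidableEq ι] {X : Set E} {F : E → ℝ}
    {g : ι → E → ℝ} (hX : Convex ℝ X) (hF : ConvexOn ℝ Set.univ F)
    (hg : ∀ i, ConvexOn ℝ Set.univ (g i)) {u : ι → ℝ} {z : Finset ι → E}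
    (hz : ∀ A, z A ∈ relaxed X g u A ∧ IsMinOn F (relaxed X g u A) (z A)) (A : Finset ι) :
    ∃ B ⊆ A, B.card ≤ Module.finrank ℝ E ∧ F (z A) ≤ F (z B) := by
  by_contra! hcon
  let G : Option ι → Set E := fun o => o.elim {y ∈ X | F y < F (z A)} fun i => {y | g i y ≤ u i}
  have hG : (⋂ o ∈ Finset.insertNone A, G o).Nonempty := by
    refine Convex.helly_theorem' (𝕜 := ℝ) ?_ ?_
    · rintro (_ | i) -
      · have := hX.inter (hF.convex_lt (F (z A)))
        simpa [G, Set.inter_def] using this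
      · simpa [G] using (hg i).convex_le (u i)
    · intro I hI hcard
      have hIA : ∀ i, some i ∈ I → i ∈ A := fun i hi => by simpa using hI hi
      by_cases hnone : none ∈ I
      · refine ⟨z I.eraseNone, Set.mem_iInter₂.2 ?_⟩
        rintro (_ | i) ho
        · refine ⟨(hz _).1.1, hcon _ (fun i hi => hIA i (by simpa using hi)) ?_⟩
          rw [Finset.card_eraseNone_of_mem hnone]
          omega
        · exact (hz _).1.2 i (by simpa using ho)
      · refine ⟨z A, Set.mem_iInter₂.2 ?_⟩
        rintro (_ | i) ho
        · exact (hnone ho).elim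
        · exact (hz A).1.2 i (hIA i ho)
  obtain ⟨y, hy⟩ := hG
  rw [Set.mem_iInter₂] at hy
  have h0 : y ∈ X ∧ F y < F (z A) := hy none (by simp)
  exact h0.2.not_ge (isMinOn_iff.1 (hz A).2 y ⟨h0.1, fun i hi => hy (some i) (by simpa using hi)⟩)

/-- Finitely many convex constraint sets, perturbed generically, cut the family of all index sets
into the intervals between a set `J` of at most `dim E` essential constraints and the complement of
a set `V` of violated ones. The set `V` contains every constraint that is violated by the
unperturbed solution. -/
theorem exists_interval_partition {ι : Type*} [Fintype ι] [DecidableEq ι] {ts : List (E → ℝ)}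
    (hts : ∀ t ∈ ts, ConvexOn ℝ Set.univ t) {Z : ι → Set E} (hZ : ∀ i, Convex ℝ (Z i))
    (hZc : ∀ i, IsClosed (Z i)) (hne : (⋂ i, Z i).Nonempty) (𝓐 : Finset (Finset ι))
    (sol : Finset ι → E) (hsol : ∀ A ∈ 𝓐, tieBreak ts (⋂ i ∈ A, Z i) = {sol A}) :
    ∃ J V : Finset ι → Finset ι, (∀ A, J A ⊆ A) ∧ (∀ A, Disjoint A (V A)) ∧
      (∀ A, (J A).card ≤ Module.finrank ℝ E) ∧
      (∀ A B, J A ⊆ B → Disjoint B (V A) → J B = J A ∧ V B = V A) ∧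
      ∀ A ∈ 𝓐, ∀ i, sol A ∉ Z i → i ∈ V A := by
  classical
  obtain ⟨p, hp⟩ := hne
  rw [Set.mem_iInter] at hp
  set R : ℝ := ‖p‖ + ∑ A ∈ 𝓐, ‖sol A‖ with hR
  have hR0 : 0 ≤ ∑ A ∈ 𝓐, ‖sol A‖ := Finset.sum_nonneg fun _ _ => norm_nonneg _
  set X : Set E := Metric.closedBall 0 R with hXdef
  have hX : Convex ℝ X := convex_closedBall 0 R
  have hXc : IsCompact X := isCompact_closedBall 0 R
  have hpX : p ∈ X := by
    rw [hXdef, mem_closedBall_zero_iff]; linarith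
  have hsolX : ∀ A ∈ 𝓐, sol A ∈ X := fun A hA => by
    rw [hXdef, mem_closedBall_zero_iff]
    have := Finset.single_le_sum (f := fun A => ‖sol A‖) (fun _ _ => norm_nonneg _) hA
    have := norm_nonneg p
    linarith
  set g : ι → E → ℝ := fun i x => Metric.infDist x (Z i) with hgdef
  have hg : ∀ i, ConvexOn ℝ Set.univ (g i) := fun i => convexOn_infDist (hZ i) ⟨p, hp i⟩
  have hgc : ∀ i, Continuous (g i) := fun i => continuous_of_convexOn_univ (hg i)
  have hg0 : ∀ i x, g i x ≤ 0 ↔ x ∈ Z i := fun i x => by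
    rw [(hZc i).mem_iff_infDist_zero ⟨p, hp i⟩]
    exact ⟨fun h => le_antisymm h Metric.infDist_nonneg, fun h => h.le⟩
  have hrel : ∀ A : Finset ι, relaxed X g 0 A = X ∩ ⋂ i ∈ A, Z i := fun A => by
    ext x; simp [relaxed, hg0]
  have hsolmem : ∀ A ∈ 𝓐, sol A ∈ ⋂ i ∈ A, Z i := fun A hA =>
    tieBreak_subset ts _ (by rw [hsol A hA]; rfl)
  -- One strictly convex objective whose minimizers violate what the selected points violate.
  obtain ⟨F, hF, hFO⟩ := exists_strictConvexOn_isMinOn_mem (ι := 𝓐) hts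
    (S := fun a => relaxed X g 0 (a : Finset ι))
    (O := fun a => ⋂ i ∈ {i | sol a ∉ Z i}, (Z i)ᶜ) (z := fun a => sol a)
    (fun a => isCompact_relaxed hXc hgc 0 _)
    (fun a => (Set.toFinite _).isOpen_biInter fun i _ => (hZc i).isOpen_compl)
    (fun a => by
      rw [hrel]
      exact tieBreak_eq_singleton_of_subset (hsol a a.2) Set.inter_subset_right
        ⟨hsolX a a.2, hsolmem a a.2⟩)
    (fun a => Set.mem_iInter₂.2 fun i hi => hi)
  have hFc := continuous_of_convexOn_univ hF.convexOn
  have hev : ∀ᶠ ρ in 𝓝[>] (0 : ℝ), ∀ a : 𝓐, ∀ i : {i // sol a ∉ Z i}, ∀ u : ι → ℝ,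
      (∀ j, 0 ≤ u j) → (∀ j, u j ≤ ρ) → ∀ x ∈ relaxed X g u (a : Finset ι),
        IsMinOn F (relaxed X g u (a : Finset ι)) x → u i < g i x := by
    refine eventually_all.2 fun a => eventually_all.2 fun i => ?_
    refine eventually_forall_lt_of_isMinOn_relaxed hXc hFc hgc _ _ fun x hx hmin => ?_
    have := Set.mem_iInter₂.1 (hFO a x hx hmin) i i.2
    exact not_le.1 fun h => this ((hg0 _ _).1 h)
  obtain ⟨ρ, hρ, hρ0⟩ := (hev.and self_mem_nhdsWithin).exists
  obtain ⟨u, hu0, huρ, z, hz, hgen⟩ := exists_generic_relaxation hX hXc hF hg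
    ⟨p, by rw [hrel]; exact ⟨hpX, by simpa using fun i => hp i⟩⟩ hρ0
  have hmono : ∀ {A B : Finset ι}, A ⊆ B → F (z A) ≤ F (z B) := fun {A B} h =>
    isMinOn_iff.1 (hz A).2 _ (relaxed_anti X g u h (hz B).1)
  have huniq : ∀ A x, x ∈ relaxed X g u A → F x ≤ F (z A) → x = z A := fun A x hx hle =>
    (hF.subset (Set.subset_univ _) (convex_relaxed hX hg u A)).eq_of_isMinOn
      (isMinOn_iff.2 fun w hw => hle.trans (isMinOn_iff.1 (hz A).2 w hw)) (hz A).2 hx (hz A).1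
  have hsub : ∀ {A B : Finset ι}, A ⊆ B → F (z B) ≤ F (z A) → z B = z A := fun {A B} h hle =>
    huniq A _ (relaxed_anti X g u h (hz B).1) hle
  -- The essential constraints form a basis.
  have hbasis : ∀ A : Finset ι, ∃ B ⊆ A, B.card ≤ Module.finrank ℝ E ∧ F (z B) = F (z A) ∧
      ∀ i ∈ A, i ∈ B ↔ F (z (A.erase i)) < F (z A) := by
    intro A
    obtain ⟨B₀, hB₀A, hB₀c, hB₀⟩ := exists_subset_card_le_finrank_le hX hF.convexOn hg hz A
    obtain ⟨B, hBB₀, hBmin⟩ := Finset.exists_min_image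
      (B₀.powerset.filter fun B => F (z A) ≤ F (z B)) Finset.card
      ⟨B₀, by simpa using hB₀⟩
    simp only [Finset.mem_filter, Finset.mem_powerset] at hBB₀ hBmin
    have hBA : B ⊆ A := hBB₀.1.trans hB₀A
    have hBval : F (z B) = F (z A) := le_antisymm (hmono hBA) hBB₀.2
    refine ⟨B, hBA, (Finset.card_le_card hBB₀.1).trans hB₀c, hBval, fun i hi => ⟨fun hiB => ?_,
      fun hlt => ?_⟩⟩
    · by_contra! hge
      have hval : F (z B) = F (z (A.erase i)) :=
        le_antisymm (hBval.trans_le hge) ((hmono (A.erase_subset i)).trans hBval.ge)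
      have hle := hgen B (A.erase i) i hiB (Finset.notMem_erase i A) hval
      have := hBmin (B.erase i)
        ⟨(B.erase_subset i).trans hBB₀.1, hBval.ge.trans hle⟩
      have hlt := Finset.card_erase_lt_of_mem hiB
      omega
    · by_contra hiB
      have := hmono (Finset.subset_erase.2 ⟨hBA, hiB⟩)
      linarith
  choose J hJA hJc hJval hJiff using hbasis
  have hJz : ∀ A, z A = z (J A) := fun A => hsub (hJA A) (hJval A).ge
  refine ⟨J, fun A => Finset.univ.filter fun i => u i < g i (z A), hJA, fun A => ?_, hJc,
    fun A B hAB hdisj => ?_, fun A hA i hi => ?_⟩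
  · rw [Finset.disjoint_left]
    intro i hiA hi
    exact (Finset.mem_filter.1 hi).2.not_ge ((hz A).1.2 i hiA)
  · have hzB : z A = z B := by
      refine huniq B _ ⟨(hz A).1.1, fun i hi => ?_⟩ ?_
      · have := Finset.disjoint_left.1 hdisj hi
        simpa using this
      · rw [hJz A]; exact hmono hAB
    refine ⟨?_, by simp only [hzB]⟩
    -- A constraint outside a basis is inessential, so either basis contains the other.
    have hJsub : ∀ {A B : Finset ι}, z A = z B → J A ⊆ B → J B ⊆ J A := by
      intro A B h hAB i hi
      by_contra hiA
      have h1 := (hJiff B i (hJA B hi)).1 hi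
      have h2 := hmono (Finset.subset_erase.2 ⟨hAB, hiA⟩)
      rw [hJval A, h] at h2
      linarith
    have hBA : J B ⊆ J A := hJsub hzB hAB
    exact Finset.Subset.antisymm hBA (hJsub hzB.symm (hBA.trans (hJA A)))
  · simpa using hρ ⟨A, hA⟩ ⟨i, hi⟩ u hu0 huρ _ (hz A).1 (hz A).2

end Partition

/-! ### Counting sets in a partition into intervals -/

section Counting

open Finset

variable {ι : Type*} [DecidableEq ι]

theorem sum_Icc_insert_add_sum_Icc_erase {M : Type*} [AddCommMonoid M] (f : Finset ι → M)
    (J T : Finset ι) (x : ι) :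
    ∑ A ∈ Icc (insert x J) T, f A + ∑ A ∈ Icc J (T.erase x), f A = ∑ A ∈ Icc J T, f A := by
  rw [← sum_filter_add_sum_filter_not (Icc J T) (fun A => x ∈ A)]
  congr 1 <;> refine sum_congr ?_ fun _ _ => rfl
  · ext A
    simp only [mem_Icc, mem_filter, insert_subset_iff]
    tauto
  · ext A
    simp only [mem_Icc, mem_filter, subset_erase]
    tauto

/-- There is a weight depending only on cardinality, vanishing below `d`, with prescribed total
over the interval between a set `J` of `d` elements and a set `T ⊇ J`, as a function of
`#T - d`. -/
theorem exists_weight_sum_Icc (d : ℕ) (Ψ : ℕ → ℤ) :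
    ∃ w : ℕ → ℤ, (∀ k < d, w k = 0) ∧
      ∀ J T : Finset ι, J ⊆ T → #J = d → ∑ A ∈ Icc J T, w #A = Ψ (#T - d) := by
  refine ⟨fun k => if k < d then 0 else (fwdDiff 1)^[k - d] Ψ 0, fun k hk => by simp [hk],
    fun J T hJT hJ => ?_⟩
  have h1 : ∑ A ∈ Icc J T, (if #A < d then 0 else (fwdDiff 1)^[#A - d] Ψ 0)
      = ∑ B ∈ (T \ J).powerset, (fwdDiff 1)^[#B] Ψ 0 := by
    refine (sum_bij' (fun B _ => J ∪ B) (fun A _ => A \ J) ?_ ?_ ?_ ?_ ?_).symm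
    · intro B hB
      rw [mem_powerset] at hB
      exact mem_Icc.2 ⟨subset_union_left, union_subset hJT (hB.trans sdiff_subset)⟩
    · intro A hA
      exact mem_powerset.2 (sdiff_subset_sdiff (mem_Icc.1 hA).2 subset_rfl)
    · intro B hB
      rw [mem_powerset] at hB
      exact union_sdiff_cancel_left (disjoint_sdiff.mono_right hB)
    · intro A hA
      exact union_sdiff_of_subset (mem_Icc.1 hA).1
    · intro B hB
      rw [mem_powerset] at hB
      rw [card_union_of_disjoint (disjoint_sdiff.mono_right hB), hJ]
      simp
  rw [h1, sum_powerset_apply_card (fun k => (fwdDiff 1)^[k] Ψ 0), card_sdiff_of_subset hJT, hJ]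
  simpa using (shift_eq_sum_fwdDiff_iter 1 Ψ (#T - d) 0).symm

variable [Fintype ι]

/-- An interval `[J, T]` that misses more than `r` elements weighs as much as it has sets of `K`
elements. The proof splits the interval by an element of `T \ J` until `J` has `d` elements. -/
theorem sum_Icc_card_eq (w : ℕ → ℤ) {d K r : ℕ} (hdK : d ≤ K) (hw0 : ∀ k < d, w k = 0)
    (hw : ∀ J T : Finset ι, J ⊆ T → #J = d →
      ∑ A ∈ Icc J T, w #A = if r < #Tᶜ then (#{A ∈ Icc J T | #A = K} : ℤ) else 0)
    {J T : Finset ι} (hJT : J ⊆ T) (hJ : #J ≤ d) (hT : r < #Tᶜ) :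
    ∑ A ∈ Icc J T, w #A = #{A ∈ Icc J T | #A = K} := by
  induction hn : #(T \ J) generalizing J T with
  | zero =>
    obtain rfl : J = T := Subset.antisymm hJT (sdiff_eq_empty_iff_subset.1 (card_eq_zero.1 hn))
    rcases hJ.eq_or_lt with hJ | hJ
    · rw [hw J J hJT hJ, if_pos hT]
    · have : #J ≠ K := by omega
      simp [hw0 _ hJ, filter_singleton, this]
  | succ n ih =>
    rcases hJ.eq_or_lt with hJ | hJ
    · rw [hw J T hJT hJ, if_pos hT]
    · obtain ⟨x, hx⟩ : (T \ J).Nonempty := card_pos.1 (by omega)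
      obtain ⟨hxT, hxJ⟩ := mem_sdiff.1 hx
      rw [← sum_Icc_insert_add_sum_Icc_erase _ J T x,
        ih (insert_subset hxT hJT) (by rw [card_insert_of_notMem hxJ]; omega) hT
          (by rw [sdiff_insert, card_erase_of_mem hx]; omega),
        ih (subset_erase.2 ⟨hJT, hxJ⟩) hJ.le
          (hT.trans_le (card_le_card (compl_subset_compl.2 (erase_subset x T))))
          (by rw [erase_sdiff_comm, card_erase_of_mem hx]; omega)]
      simp only [card_filter, Nat.cast_sum]
      exact sum_Icc_insert_add_sum_Icc_erase _ J T x

/-- An interval `[J, T]` that misses at most `r` elements weighs as much as it has sets `A` of `K`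
elements with `#(A ∩ R) + #J < d`, for any `R ⊆ T \ J` of the right size. The proof splits the
interval by the elements of `R` one at a time, which ends when `J` has `d` elements or `T` misses
more than `r`. -/
theorem sum_Icc_card_eq_card_inter_lt (w : ℕ → ℤ) {d K r : ℕ} (hdK : d ≤ K)
    (hw0 : ∀ k < d, w k = 0)
    (hw : ∀ J T : Finset ι, J ⊆ T → #J = d →
      ∑ A ∈ Icc J T, w #A = if r < #Tᶜ then (#{A ∈ Icc J T | #A = K} : ℤ) else 0)
    {J T R : Finset ι} (hJT : J ⊆ T) (hJ : #J ≤ d) (hT : #Tᶜ ≤ r) (hR : R ⊆ T \ J)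
    (hRc : #R + #J + #Tᶜ = r + d) :
    ∑ A ∈ Icc J T, w #A = #{A ∈ Icc J T | #A = K ∧ #(A ∩ R) + #J < d} := by
  induction hn : #R generalizing J T R with
  | zero =>
    have hJd : #J = d := by omega
    rw [hw J T hJT hJd, if_neg (by omega)]
    simp [hJd]
  | succ n ih =>
    rcases hJ.eq_or_lt with hJ | hJ
    · rw [hw J T hJT hJ, if_neg (by omega)]
      simp [hJ]
    · obtain ⟨x, hx⟩ : R.Nonempty := card_pos.1 (by omega)
      obtain ⟨hxT, hxJ⟩ := mem_sdiff.1 (hR hx)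
      have hRx : #(R.erase x) = n := by rw [card_erase_of_mem hx]; omega
      have hJx : #(insert x J) = #J + 1 := card_insert_of_notMem hxJ
      have hTx : #(T.erase x)ᶜ = #Tᶜ + 1 := by
        rw [compl_erase, card_insert_of_notMem (by simpa using hxT)]
      have e1 : #{A ∈ Icc (insert x J) T | #A = K ∧ #(A ∩ R.erase x) + #(insert x J) < d}
          = #{A ∈ Icc (insert x J) T | #A = K ∧ #(A ∩ R) + #J < d} := by
        congr 1
        refine filter_congr fun A hA => ?_
        have hxA : x ∈ A := (mem_Icc.1 hA).1 (mem_insert_self x J)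
        have : #(A ∩ R) = #(A ∩ R.erase x) + 1 := by
          rw [inter_erase, card_erase_of_mem (mem_inter.2 ⟨hxA, hx⟩)]
          have := card_pos.2 ⟨x, mem_inter.2 ⟨hxA, hx⟩⟩
          omega
        rw [hJx, this]
        omega
      have e2 : ∀ A ∈ Icc J (T.erase x), A ∩ R.erase x = A ∩ R := fun A hA => by
        rw [inter_erase, erase_eq_of_notMem]
        exact fun h => (subset_erase.1 (mem_Icc.1 hA).2).2 (mem_inter.1 h).1
      have h1 := ih (J := insert x J) (T := T) (R := R.erase x) (insert_subset hxT hJT) (by omega) hT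
        (by rw [sdiff_insert]; exact erase_subset_erase x hR) (by omega) hRx
      have h2 : ∑ A ∈ Icc J (T.erase x), w #A
          = #{A ∈ Icc J (T.erase x) | #A = K ∧ #(A ∩ R) + #J < d} := by
        rcases hT.eq_or_lt with hT | hT
        · rw [sum_Icc_card_eq w hdK hw0 hw (subset_erase.2 ⟨hJT, hxJ⟩) hJ.le (by omega)]
          congr 2
          refine filter_congr fun A hA => ?_
          have := card_le_card (inter_subset_right (s₁ := A) (s₂ := R.erase x))
          rw [e2 A hA] at this
          have : #(A ∩ R) + #J < d := by omega
          simp [this]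
        · rw [ih (J := J) (T := T.erase x) (R := R.erase x) (subset_erase.2 ⟨hJT, hxJ⟩) hJ.le
            (by omega) (by rw [erase_sdiff_comm]; exact erase_subset_erase x hR) (by omega) hRx]
          congr 2
          refine filter_congr fun A hA => ?_
          rw [e2 A hA]
      rw [← sum_Icc_insert_add_sum_Icc_erase _ J T x, h1, h2, e1]
      simp only [card_filter, Nat.cast_sum]
      exact sum_Icc_insert_add_sum_Icc_erase _ J T x

theorem card_filter_card_inter_lt (R : Finset ι) {d K : ℕ} (hdK : d ≤ K) :
    #{A : Finset ι | #A = K ∧ #(A ∩ R) < d}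
      = ∑ i ∈ range d, (#R).choose i * (Fintype.card ι - #R).choose (K - i) := by
  have hmaps : ∀ A ∈ ({A : Finset ι | #A = K ∧ #(A ∩ R) < d} : Finset (Finset ι)),
      #(A ∩ R) ∈ range d := fun A hA => mem_range.2 (mem_filter.1 hA).2.2
  rw [card_eq_sum_card_fiberwise hmaps]
  refine sum_congr rfl fun i hi => ?_
  rw [mem_range] at hi
  rw [← card_compl, ← card_powersetCard, ← card_powersetCard, ← card_product]
  refine card_bij' (fun A _ => (A ∩ R, A \ R)) (fun p _ => p.1 ∪ p.2) ?_ ?_ ?_ ?_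
  · intro A hA
    simp only [mem_filter, mem_univ, true_and] at hA
    have := card_inter_add_card_sdiff A R
    simp only [mem_product, mem_powersetCard]
    exact ⟨⟨inter_subset_right, hA.2⟩, fun x hx => by simpa using (mem_sdiff.1 hx).2, by omega⟩
  · rintro ⟨B, C⟩ hp
    simp only [mem_product, mem_powersetCard] at hp
    obtain ⟨⟨hB, hBc⟩, hC, hCc⟩ := hp
    have hdisj : Disjoint C R := disjoint_left.2 fun x hx => by simpa using hC hx
    have hBR : (B ∪ C) ∩ R = B := by
      rw [union_inter_distrib_right, inter_eq_left.2 hB, disjoint_iff_inter_eq_empty.1 hdisj,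
        union_empty]
    simp only [mem_filter, mem_univ, true_and, hBR]
    rw [card_union_of_disjoint (hdisj.symm.mono_left hB)]
    omega
  · intro A hA
    exact (union_comm _ _).trans (sdiff_union_inter A R)
  · rintro ⟨B, C⟩ hp
    simp only [mem_product, mem_powersetCard] at hp
    obtain ⟨⟨hB, hBc⟩, hC, hCc⟩ := hp
    have hdisj : Disjoint C R := disjoint_left.2 fun x hx => by simpa using hC hx
    simp only [Prod.mk.injEq]
    constructor
    · rw [union_inter_distrib_right, inter_eq_left.2 hB, disjoint_iff_inter_eq_empty.1 hdisj,
        union_empty]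
    · rw [union_sdiff_distrib, sdiff_eq_empty_iff_subset.2 hB, empty_union,
        sdiff_eq_self_of_disjoint hdisj]

/-- If the family of all subsets is partitioned into intervals `[J, Vᶜ]` with `#J ≤ d`, then among
the sets of `K` elements at most as many lie in an interval with `#V > r` as there are sets with
fewer than `d` elements in a fixed set of `r + d` elements. -/
theorem card_filter_lt_card_le {J V : Finset ι → Finset ι} {d K r : ℕ} (hdK : d ≤ K)
    (hr : r + d ≤ Fintype.card ι) (hJA : ∀ A, J A ⊆ A) (hV : ∀ A, Disjoint A (V A))
    (hJ : ∀ A, #(J A) ≤ d) (h : ∀ A B, J A ⊆ B → Disjoint B (V A) → J B = J A ∧ V B = V A) :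
    #{A : Finset ι | #A = K ∧ r < #(V A)}
      ≤ ∑ i ∈ range d, (r + d).choose i * (Fintype.card ι - (r + d)).choose (K - i) := by
  have hJV : ∀ A, J A ⊆ (V A)ᶜ := fun A => (hJA A).trans (le_compl_iff_disjoint_right.2 (hV A))
  obtain ⟨w, hw0, hw⟩ := exists_weight_sum_Icc (ι := ι) d
    (fun s => if r + d + s < Fintype.card ι then (s.choose (K - d) : ℤ) else 0)
  have hcount : ∀ S T : Finset ι, S ⊆ T → #S = d →
      #{A ∈ Icc S T | #A = K} = (#T - d).choose (K - d) := by
    intro S T hST hS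
    rw [← hS, ← card_sdiff_of_subset hST, ← card_powersetCard]
    refine card_bij' (fun A _ => A \ S) (fun B _ => S ∪ B) ?_ ?_ ?_ ?_
    · intro A hA
      simp only [mem_filter, mem_Icc] at hA
      rw [mem_powersetCard, card_sdiff_of_subset hA.1.1, hA.2]
      exact ⟨sdiff_subset_sdiff hA.1.2 subset_rfl, rfl⟩
    · intro B hB
      rw [mem_powersetCard] at hB
      simp only [mem_filter, mem_Icc]
      rw [card_union_of_disjoint (disjoint_sdiff.mono_right hB.1)]
      exact ⟨⟨subset_union_left, union_subset hST (hB.1.trans sdiff_subset)⟩, by omega⟩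
    · intro A hA
      exact union_sdiff_of_subset (mem_Icc.1 (mem_filter.1 hA).1).1
    · intro B hB
      exact union_sdiff_cancel_left (disjoint_sdiff.mono_right (mem_powersetCard.1 hB).1)
  have hw' : ∀ S T : Finset ι, S ⊆ T → #S = d →
      ∑ A ∈ Icc S T, w #A = if r < #Tᶜ then (#{A ∈ Icc S T | #A = K} : ℤ) else 0 := by
    intro S T hST hS
    rw [hw S T hST hS, hcount S T hST hS, card_compl]
    have h1 := card_le_card hST
    have h2 := card_le_univ T
    refine if_congr ?_ rfl rfl
    omega
  -- Each interval contributes at least as much weight as it has bad sets.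
  have hlow : ∀ S T : Finset ι, S ⊆ T → #S ≤ d →
      (if r < #Tᶜ then (#{A ∈ Icc S T | #A = K} : ℤ) else 0) ≤ ∑ A ∈ Icc S T, w #A := by
    intro S T hST hS
    split_ifs with hT
    · exact (sum_Icc_card_eq w hdK hw0 hw' hST hS hT).ge
    · have h1 := card_sdiff_of_subset hST
      have h2 := card_le_card hST
      have h3 := card_compl T
      have h4 := card_le_univ T
      obtain ⟨R, hR, hRc⟩ := exists_subset_card_eq
        (show r + d - #S - #Tᶜ ≤ #(T \ S) by omega)
      rw [sum_Icc_card_eq_card_inter_lt w hdK hw0 hw' hST hS (not_lt.1 hT) hR (by omega)]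
      positivity
  obtain ⟨R, -, hRc⟩ := exists_subset_card_eq (s := (univ : Finset ι)) (n := r + d) (by simpa)
  have htot := sum_Icc_card_eq_card_inter_lt w hdK hw0 hw' (J := ∅) (T := univ) (R := R)
    (subset_univ _) (by simp) (by simp) (by simp) (by simpa using hRc)
  have hIcc : Icc (∅ : Finset ι) univ = univ := by
    ext A; simp
  rw [hIcc] at htot
  simp only [card_empty, add_zero] at htot
  rw [card_filter_card_inter_lt R hdK, hRc] at htot
  have hfib : ∀ A : Finset ι,
      (univ.filter fun B => (J B, V B) = (J A, V A)) = Icc (J A) (V A)ᶜ := by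
    intro A
    ext B
    simp only [mem_filter, mem_univ, true_and, Prod.mk.injEq, mem_Icc]
    constructor
    · rintro ⟨h1, h2⟩
      exact ⟨h1 ▸ hJA B, h2 ▸ le_compl_iff_disjoint_right.2 (hV B)⟩
    · rintro ⟨h1, h2⟩
      exact h A B h1 (le_compl_iff_disjoint_right.1 h2)
  suffices hle : (#{A : Finset ι | #A = K ∧ r < #(V A)} : ℤ) ≤ ∑ A : Finset ι, w #A by
    rw [htot] at hle
    exact_mod_cast hle
  rw [card_filter, Nat.cast_sum,
    ← sum_fiberwise_of_maps_to (g := fun A => (J A, V A)) (t := univ.image fun A => (J A, V A))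
      (fun A _ => mem_image_of_mem _ (mem_univ A)),
    ← sum_fiberwise_of_maps_to (g := fun A => (J A, V A)) (t := univ.image fun A => (J A, V A))
      (fun A _ => mem_image_of_mem _ (mem_univ A)) (fun A => w #A)]
  refine sum_le_sum fun p hp => ?_
  obtain ⟨A, -, rfl⟩ := mem_image.1 hp
  have hlow' := hlow _ _ (hJV A) (hJ A)
  rw [compl_compl] at hlow'
  rw [hfib A]
  refine le_trans (le_of_eq ?_) hlow'
  have hVB : ∀ B ∈ Icc (J A) (V A)ᶜ, V B = V A := fun B hB =>
    (h A B (mem_Icc.1 hB).1 (le_compl_iff_disjoint_right.1 (mem_Icc.1 hB).2)).2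
  rw [sum_congr rfl fun B hB => by rw [hVB B hB]]
  split_ifs with hr'
  · simp [hr']
  · simp [hr']

end Counting

/-! ### Limits of hypergeometric tails -/

section Limits

open Filter Topology Asymptotics

theorem tendsto_choose_div_pow {a : ℕ → ℕ} {α : ℝ} (hα : 0 < α)
    (ha : Tendsto (fun m => (a m : ℝ) / m) atTop (𝓝 α)) (i : ℕ) :
    Tendsto (fun m => ((a m).choose i : ℝ) / (m : ℝ) ^ i) atTop (𝓝 (α ^ i / i.factorial)) := by
  have hat : Tendsto (fun m => (a m : ℝ)) atTop atTop := by
    have h := Tendsto.pos_mul_atTop hα ha tendsto_natCast_atTop_atTop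
    refine h.congr' ?_
    filter_upwards [eventually_gt_atTop 0] with m hm
    have : (m : ℝ) ≠ 0 := by positivity
    field_simp
  have h1 := (isEquivalent_choose i).comp_tendsto (tendsto_natCast_atTop_iff.1 hat)
  have h2 := h1.div (IsEquivalent.refl (u := fun m : ℕ => (m : ℝ) ^ i))
  refine h2.symm.tendsto_nhds ?_
  refine ((ha.pow i).div_const (i.factorial : ℝ)).congr fun m => ?_
  simp only [Pi.div_apply, Function.comp_apply, div_pow]
  ring

/-- Hypergeometric tails converge to the binomial tail. -/
theorem tendsto_sum_choose_mul_choose_div {d K : ℕ} (hdK : d ≤ K) {α : ℝ} 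
    (hα : α ∈ Set.Ioo (0 : ℝ) 1) :
    Tendsto (fun m : ℕ => (∑ i ∈ Finset.range d, ((⌊α * m⌋₊ + d).choose i : ℝ) *
        ((m + K - (⌊α * m⌋₊ + d)).choose (K - i) : ℝ)) / ((m + K).choose K : ℝ)) atTop
      (𝓝 (∑ i ∈ Finset.range d, (K.choose i : ℝ) * α ^ i * (1 - α) ^ (K - i))) := by
  obtain ⟨hα0, hα1⟩ := hα
  have hcast : Tendsto (fun m : ℕ => (m : ℝ)) atTop atTop := tendsto_natCast_atTop_atTop
  have hfl : Tendsto (fun m : ℕ => (⌊α * m⌋₊ : ℝ) / m) atTop (𝓝 α) :=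
    (tendsto_nat_floor_mul_div_atTop hα0.le).comp hcast
  have hc : ∀ c : ℝ, Tendsto (fun m : ℕ => c / (m : ℝ)) atTop (𝓝 0) :=
    fun c => tendsto_const_nhds.div_atTop hcast
  have ha : Tendsto (fun m : ℕ => ((⌊α * m⌋₊ + d : ℕ) : ℝ) / m) atTop (𝓝 α) := by
    have := hfl.add (hc d)
    rw [add_zero] at this
    refine this.congr fun m => ?_
    push_cast
    ring
  have hb : Tendsto (fun m : ℕ => ((m + K - (⌊α * m⌋₊ + d) : ℕ) : ℝ) / m) atTop (𝓝 (1 - α)) := by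
    have h1 := ((tendsto_const_nhds (x := (1 : ℝ))).add (hc K)).sub ha
    rw [add_zero] at h1
    refine h1.congr' ?_
    filter_upwards [eventually_gt_atTop 0] with m hm
    have hm' : (m : ℝ) ≠ 0 := by positivity
    have hle : ⌊α * m⌋₊ ≤ m := by
      refine Nat.floor_le_of_le ?_
      exact mul_le_of_le_one_left (Nat.cast_nonneg m) hα1.le
    rw [Nat.cast_sub (by omega)]
    push_cast
    field_simp
  have hN : Tendsto (fun m : ℕ => ((m + K : ℕ) : ℝ) / m) atTop (𝓝 1) := by
    have h1 := (tendsto_const_nhds (x := (1 : ℝ))).add (hc K)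
    rw [add_zero] at h1
    refine h1.congr' ?_
    filter_upwards [eventually_gt_atTop 0] with m hm
    have hm' : (m : ℝ) ≠ 0 := by positivity
    push_cast
    field_simp
  have hden := tendsto_choose_div_pow one_pos hN K
  simp only [Finset.sum_div]
  refine tendsto_finsetSum _ fun i hi => ?_
  have hiK : i ≤ K := (Finset.mem_range.1 hi).le.trans hdK
  have h := ((tendsto_choose_div_pow hα0 ha i).mul
    (tendsto_choose_div_pow (sub_pos.2 hα1) hb (K - i))).div hden (by positivity)
  have hlim : α ^ i / i.factorial * ((1 - α) ^ (K - i) / (K - i).factorial) /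
      (1 ^ K / K.factorial) = (K.choose i : ℝ) * α ^ i * (1 - α) ^ (K - i) := by
    rw [Nat.cast_choose ℝ hiK]
    field_simp
    simp
  rw [hlim] at h
  refine h.congr' ?_
  filter_upwards [eventually_gt_atTop 0] with m hm
  have hm' : (m : ℝ) ≠ 0 := by positivity
  simp only [Pi.div_apply]
  have hp : (m : ℝ) ^ K = (m : ℝ) ^ i * (m : ℝ) ^ (K - i) := by
    rw [← pow_add, Nat.add_sub_cancel' hiK]
  rw [div_mul_div_comm, ← hp, div_div_div_cancel_right₀ (by positivity)]

end Limits

/-! ### Counting hits in independent trials -/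

section Sampling

open ProbabilityTheory

variable {Δ : Type*} [MeasurableSpace Δ] {μ : Measure Δ} [IsProbabilityMeasure μ]

theorem measurable_card_filter {α β : Type*} [MeasurableSpace α] [Fintype β] {p : α → β → Prop}
    [∀ a, DecidablePred (p a)] (hp : ∀ j, MeasurableSet {a | p a j}) :
    Measurable fun a => (Finset.univ.filter (p a)).card := by
  simp only [Finset.card_filter]
  exact Finset.measurable_fun_sum _ fun j _ =>
    Measurable.ite (hp j) measurable_const measurable_const

/-- By Chebyshev's inequality, the number of hits of an event of probability more than `ε` in `m`
independent trials is rarely as small as `ε' m` with `ε' < ε`. -/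
theorem one_sub_le_measureReal_lt_card {p : Δ → Prop} [DecidablePred p]
    (hB : MeasurableSet {δ | p δ}) {ε ε' : ℝ} {m r : ℕ}
    (hm : 0 < m) (hε' : ε' < ε) (hr : (r : ℝ) ≤ ε' * m) (hBε : ε < μ.real {δ | p δ}) :
    1 - 1 / (m * (ε - ε') ^ 2) ≤ (Measure.pi fun _ : Fin m => μ).real
      {b | r < (Finset.univ.filter fun j => p (b j)).card} := by
  set B := {δ | p δ} with hBdef
  set P := Measure.pi fun _ : Fin m => μ with hP
  set X : Fin m → Δ → ℝ := fun _ => B.indicator 1 with hX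
  have hXm : Measurable (B.indicator (1 : Δ → ℝ)) := measurable_one.indicator hB
  have hXb : ∀ x, ‖B.indicator (1 : Δ → ℝ) x‖ ≤ 1 := fun x =>
    (norm_indicator_le_norm_self _ _).trans (by simp)
  have hL : MemLp (B.indicator (1 : Δ → ℝ)) 2 μ :=
    MemLp.of_bound hXm.aestronglyMeasurable 1 (Filter.Eventually.of_forall hXb)
  set S : (Fin m → Δ) → ℝ := ∑ j, fun b => X j (b j) with hS
  have hSapp : ∀ b, S b = (Finset.univ.filter fun j => p (b j)).card := fun b => by
    simp [hS, hX, hBdef, Finset.sum_apply, Set.indicator_apply]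
  have hLS : ∀ j : Fin m, MemLp (fun b : Fin m → Δ => X j (b j)) 2 P := fun j =>
    hL.comp_measurePreserving (measurePreserving_eval (fun _ : Fin m => μ) j)
  have hvar : Var[S; P] ≤ m := by
    rw [hS, hP, variance_sum_pi fun _ => hL]
    refine (Finset.sum_le_card_nsmul _ _ 1 fun j _ => ?_).trans (by simp)
    refine (variance_le_expectation_sq hL.aestronglyMeasurable).trans ?_
    calc μ[(B.indicator (1 : Δ → ℝ)) ^ 2] ≤ ∫ _, (1 : ℝ) ∂μ := by
          refine integral_mono hL.integrable_sq (integrable_const 1) fun x => ?_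
          have := hXb x
          simp only [Pi.pow_apply]
          exact (sq_le_one_iff_abs_le_one _).2 this
      _ = 1 := by simp
  have hmean : P[S] = m * μ.real B := by
    have h1 : P[S] = ∑ j : Fin m, ∫ b, X j (b j) ∂P := by
      rw [← integral_finsetSum _ fun j _ => (hLS j).integrable one_le_two]
      simp [hS, Finset.sum_apply]
    have h2 : ∀ j : Fin m, ∫ b, X j (b j) ∂P = μ.real B := fun j => by
      have hmp := measurePreserving_eval (fun _ : Fin m => μ) j
      have := integral_map (μ := P) hmp.measurable.aemeasurable
        (f := B.indicator (1 : Δ → ℝ)) hXm.aestronglyMeasurable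
      rw [hmp.map_eq, integral_indicator_one hB] at this
      exact this.symm
    simp [h1, h2]
  have hmpos : (0 : ℝ) < m := by exact_mod_cast hm
  have hc : 0 < m * (ε - ε') := mul_pos hmpos (sub_pos.2 hε')
  have hcheb := meas_ge_le_variance_div_sq (memLp_finsetSum' Finset.univ fun j _ => hLS j) hc
  have hmeas : MeasurableSet {b : Fin m → Δ | r < (Finset.univ.filter fun j => p (b j)).card} :=
    measurable_card_filter (fun j => measurable_pi_apply j hB) (measurableSet_Ioi (a := r))
  have hsub : {b : Fin m → Δ | r < (Finset.univ.filter fun j => p (b j)).card}ᶜ ⊆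
      {b | m * (ε - ε') ≤ |S b - P[S]|} := by
    intro b hb
    have hb' : (Finset.univ.filter fun j => p (b j)).card ≤ r := not_lt.1 hb
    have hb'' : S b ≤ r := by rw [hSapp]; exact_mod_cast hb'
    have : m * ε ≤ P[S] := by rw [hmean]; gcongr
    have h2 : m * (ε - ε') ≤ -(S b - P[S]) := by linarith
    exact h2.trans (neg_le_abs _)
  have hle : P.real {b : Fin m → Δ | r < (Finset.univ.filter fun j => p (b j)).card}ᶜ ≤
      1 / (m * (ε - ε') ^ 2) := by
    refine (measureReal_mono hsub).trans ?_
    refine (ENNReal.toReal_mono ENNReal.ofReal_ne_top hcheb).trans ?_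
    rw [ENNReal.toReal_ofReal (div_nonneg (variance_nonneg _ _) (sq_nonneg _))]
    refine (div_le_div_of_nonneg_right hvar (sq_nonneg _)).trans (le_of_eq ?_)
    have : ε - ε' ≠ 0 := (sub_pos.2 hε').ne'
    field_simp
  rw [probReal_compl_eq_one_sub hmeas] at hle
  linarith

end Sampling

/-! ### The violation probability of sampled convex programs -/

section Guarantee

open Filter Topology

variable {Δ : Type*}

/-- A sample, restricted to a set `A` of `K` indices, listed in increasing order. -/
def subsample {N K : ℕ} (ω : Fin N → Δ) (A : {A : Finset (Fin N) // A.card = K}) : Fin K → Δ :=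
  fun k => ω (A.1.orderEmbOfFin A.2 k)

theorem iInter_subsample {E : Type*} {N K : ℕ} (Z : Δ → Set E) (ω : Fin N → Δ)
    (A : {A : Finset (Fin N) // A.card = K}) :
    ⋂ k, Z (subsample ω A k) = ⋂ i ∈ A.1, Z (ω i) := by
  ext x
  simp only [Set.mem_iInter, subsample]
  refine ⟨fun h i hi => ?_, fun h k => h _ (Finset.orderEmbOfFin_mem _ _ _)⟩
  have : i ∈ Set.range (A.1.orderEmbOfFin A.2) := by
    rw [Finset.range_orderEmbOfFin]; exact hi
  obtain ⟨k, rfl⟩ := this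
  exact h k

open Classical in
/-- Among the subsamples of `K` scenarios, the number of those whose solution is violated by more
than `r` of the scenarios is at most the number of `K`-element sets of scenarios with fewer than
`finrank ℝ E` elements in a fixed set of `r + finrank ℝ E` scenarios. -/
theorem card_subsample_violated_le {E : Type*} [NormedAddCommGroup E] [NormedSpace ℝ E]
    [FiniteDimensional ℝ E] {ts : List (E → ℝ)} (hts : ∀ t ∈ ts, ConvexOn ℝ Set.univ t)
    {Z : Δ → Set E} (hZ : ∀ δ, Convex ℝ (Z δ)) (hZc : ∀ δ, IsClosed (Z δ)) {N K r : ℕ}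
    (hK : Module.finrank ℝ E ≤ K) (hr : r + Module.finrank ℝ E ≤ N)
    (sol : (Fin K → Δ) → E) (ω : Fin N → Δ) (hne : (⋂ i, Z (ω i)).Nonempty)
    (hsol : ∀ A, tieBreak ts (⋂ k, Z (subsample ω A k)) = {sol (subsample ω A)}) :
    (Finset.univ.filter fun A : {A : Finset (Fin N) // A.card = K} =>
        r < (Finset.univ.filter fun i => sol (subsample ω A) ∉ Z (ω i)).card).card
      ≤ ∑ i ∈ Finset.range (Module.finrank ℝ E), (r + Module.finrank ℝ E).choose i *
          (N - (r + Module.finrank ℝ E)).choose (K - i) := by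
  obtain ⟨J, V, hJA, hV, hJ, hJV, hviol⟩ := exists_interval_partition hts (fun i => hZ (ω i))
    (fun i => hZc (ω i)) hne (Finset.univ.filter fun A => A.card = K)
    (fun A => if h : A.card = K then sol (subsample ω ⟨A, h⟩) else 0) (by
      intro A hA
      have hA' : A.card = K := by simpa using hA
      rw [dif_pos hA', ← hsol ⟨A, hA'⟩, iInter_subsample])
  have hle := card_filter_lt_card_le (r := r) hK (by simpa using hr) hJA hV hJ hJV
  rw [Fintype.card_fin] at hle
  refine le_trans ?_ hle
  refine Finset.card_le_card_of_injOn Subtype.val ?_ Subtype.val_injective.injOn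
  intro A hA
  have hA' := (Finset.mem_filter.1 hA).2
  refine Finset.mem_coe.2 (Finset.mem_filter.2 ⟨Finset.mem_univ _, A.2, hA'.trans_le ?_⟩)
  refine Finset.card_le_card fun i hi => ?_
  refine hviol A.1 (by simpa using A.2) i ?_
  rw [dif_pos A.2]
  exact (Finset.mem_filter.1 hi).2

variable [MeasurableSpace Δ] {μ : Measure Δ} [IsProbabilityMeasure μ]

theorem card_compl_of_card_eq {K m : ℕ} {A : Finset (Fin (m + K))} (hA : A.card = K) :
    Aᶜ.card = m := by
  rw [Finset.card_compl, Fintype.card_fin, hA]; omega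

/-- A subsample and its complementary subsample are independent samples. -/
theorem measurePreserving_subsample_prod {K m : ℕ} (A : {A : Finset (Fin (m + K)) // A.card = K}) :
    MeasurePreserving
      (fun ω : Fin (m + K) → Δ =>
        (subsample ω A, subsample ω ⟨A.1ᶜ, card_compl_of_card_eq A.2⟩))
      (Measure.pi fun _ => μ) ((Measure.pi fun _ => μ).prod (Measure.pi fun _ => μ)) := by
  let e := finSumEquivOfFinset A.2 (card_compl_of_card_eq A.2)
  exact (measurePreserving_sumPiEquivProdPi fun _ : Fin K ⊕ Fin m => μ).comp
    ((measurePreserving_piCongrLeft (fun _ : Fin (m + K) => μ) e).symm)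

open Classical in
/-- The pairs of `K` scenarios and `m` further scenarios such that the solution of the former is
violated by more than `r` of the latter. -/
def violatedPairs {E : Type*} (Z : Δ → Set E) {K : ℕ} (sol : (Fin K → Δ) → E) (m r : ℕ) :
    Set ((Fin K → Δ) × (Fin m → Δ)) :=
  {p | r < (Finset.univ.filter fun j => sol p.1 ∉ Z (p.2 j)).card}

theorem measurableSet_violatedPairs {E : Type*} [MeasurableSpace E] {Z : Δ → Set E}
    (hZm : MeasurableSet {p : E × Δ | p.1 ∈ Z p.2}) {K : ℕ} {sol : (Fin K → Δ) → E}
    (hsol : Measurable sol) (m r : ℕ) : MeasurableSet (violatedPairs Z sol m r) := by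
  have h : ∀ j : Fin m, MeasurableSet {p : (Fin K → Δ) × (Fin m → Δ) | sol p.1 ∉ Z (p.2 j)} :=
    fun j => by
      have hf : Measurable fun p : (Fin K → Δ) × (Fin m → Δ) => (sol p.1, p.2 j) := by fun_prop
      exact (hf hZm).compl
  classical
  exact measurable_card_filter h (measurableSet_Ioi (a := r))

/-- A solution with violation probability above `ε` is violated by more than `r` of the further
scenarios up to a small probability. -/
theorem mul_measureReal_le_measureReal_violatedPairs {E : Type*} [MeasurableSpace E] {Z : Δ → Set E}
    (hZm : MeasurableSet {p : E × Δ | p.1 ∈ Z p.2}) {K : ℕ} {sol : (Fin K → Δ) → E}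
    (hsol : Measurable sol) {ε ε' : ℝ} {m r : ℕ} (hm : 0 < m) (hε' : ε' < ε)
    (hr : (r : ℝ) ≤ ε' * m) :
    (1 - 1 / (m * (ε - ε') ^ 2)) *
        (Measure.pi fun _ : Fin K => μ).real {ω | ε < μ.real {δ | sol ω ∉ Z δ}} ≤
      ((Measure.pi fun _ => μ).prod (Measure.pi fun _ => μ)).real (violatedPairs Z sol m r) := by
  set P := Measure.pi fun _ : Fin K => μ
  set Q := Measure.pi fun _ : Fin m => μ
  have hS := measurableSet_violatedPairs hZm hsol m r
  have hviol : Measurable fun ω => μ.real {δ | sol ω ∉ Z δ} := by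
    have hf : Measurable fun p : (Fin K → Δ) × Δ => (sol p.1, p.2) := by fun_prop
    exact (measurable_measure_prodMk_left (hf hZm).compl).ennreal_toReal
  have hbad : MeasurableSet {ω | ε < μ.real {δ | sol ω ∉ Z δ}} := hviol measurableSet_Ioi
  set bad := {ω | ε < μ.real {δ | sol ω ∉ Z δ}} with hbad_def
  rcases le_or_gt (1 - 1 / (m * (ε - ε') ^ 2)) 0 with hc | hc
  · exact (mul_nonpos_of_nonpos_of_nonneg hc measureReal_nonneg).trans measureReal_nonneg
  · have hle : ENNReal.ofReal (1 - 1 / (m * (ε - ε') ^ 2)) * P bad ≤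
        (P.prod Q) (violatedPairs Z sol m r) := by
      rw [Measure.prod_apply hS, ← setLIntegral_const]
      refine (setLIntegral_mono' hbad fun a ha => ?_).trans (setLIntegral_le_lintegral _ _)
      have hB : MeasurableSet {δ | sol a ∉ Z δ} := by
        have hf : Measurable fun δ : Δ => (sol a, δ) := by fun_prop
        exact (hf hZm).compl
      classical
      refine (ENNReal.ofReal_le_ofReal (one_sub_le_measureReal_lt_card hB hm hε' hr ha)).trans ?_
      exact ENNReal.ofReal_toReal_le
    have := ENNReal.toReal_mono (measure_ne_top _ _) hle
    rwa [ENNReal.toReal_mul, ENNReal.toReal_ofReal hc.le] at this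

variable {E : Type*} [NormedAddCommGroup E] [NormedSpace ℝ E] [FiniteDimensional ℝ E]

/-- The binomial tail bound for the violation probability of the solution of a convex program with
sampled constraints, in dimension `finrank ℝ E`. Only samples of the given size `K` need to have a
unique solution, and only almost surely. -/
theorem measureReal_lt_violation_le [MeasurableSpace E] {ts : List (E → ℝ)} (hts : ∀ t ∈ ts, ConvexOn ℝ Set.univ t)
    {Z : Δ → Set E} (hZ : ∀ δ, Convex ℝ (Z δ)) (hZc : ∀ δ, IsClosed (Z δ))
    (hZm : MeasurableSet {p : E × Δ | p.1 ∈ Z p.2}) {K : ℕ} (hK : Module.finrank ℝ E ≤ K)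
    (hne : ∀ N, K ≤ N → ∀ ω : Fin N → Δ,
      (∀ A : {A : Finset (Fin N) // A.card = K}, (⋂ i ∈ A.1, Z (ω i)).Nonempty) →
        (⋂ i, Z (ω i)).Nonempty)
    {sol : (Fin K → Δ) → E} (hsolm : Measurable sol)
    (hsol : ∀ᵐ ω ∂Measure.pi fun _ : Fin K => μ, tieBreak ts (⋂ k, Z (ω k)) = {sol ω})
    {ε : ℝ} (hε : ε ∈ Set.Ioo (0 : ℝ) 1) :
    (Measure.pi fun _ : Fin K => μ).real {ω | ε < μ.real {δ | sol ω ∉ Z δ}} ≤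
      ∑ i ∈ Finset.range (Module.finrank ℝ E),
        (K.choose i : ℝ) * ε ^ i * (1 - ε) ^ (K - i) := by
  classical
  set d := Module.finrank ℝ E with hd
  set p := (Measure.pi fun _ : Fin K => μ).real {ω | ε < μ.real {δ | sol ω ∉ Z δ}} with hp
  have key : ∀ (m r : ℕ) (ε' : ℝ), 0 < m → ε' < ε → (r : ℝ) ≤ ε' * m → r ≤ m →
      (1 - 1 / (m * (ε - ε') ^ 2)) * p ≤ (∑ i ∈ Finset.range d, ((r + d).choose i : ℝ) *
        ((m + K - (r + d)).choose (K - i) : ℝ)) / ((m + K).choose K : ℝ) := by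
    intro m r ε' hm hε' hr hrm
    set P := Measure.pi fun _ : Fin (m + K) => μ with hP
    let q : {A : Finset (Fin (m + K)) // A.card = K} → (Fin (m + K) → Δ) →
        (Fin K → Δ) × (Fin m → Δ) := fun A ω =>
      (subsample ω A, subsample ω ⟨A.1ᶜ, card_compl_of_card_eq A.2⟩)
    have hq : ∀ A, MeasurePreserving (q A) P _ := fun A => measurePreserving_subsample_prod A
    have hS := measurableSet_violatedPairs hZm hsolm m r
    set S := violatedPairs Z sol m r with hSdef
    have hgood : ∀ᵐ ω ∂P, ∀ A : {A : Finset (Fin (m + K)) // A.card = K},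
        tieBreak ts (⋂ k, Z (subsample ω A k)) = {sol (subsample ω A)} :=
      ae_all_iff.2 fun A =>
        (measurePreserving_fst.comp (hq A)).quasiMeasurePreserving.ae hsol
    have hcount : ∀ᵐ ω ∂P, ∑ A, (q A ⁻¹' S).indicator (1 : (Fin (m + K) → Δ) → ℝ) ω ≤
        ∑ i ∈ Finset.range d, ((r + d).choose i : ℝ) *
          ((m + K - (r + d)).choose (K - i) : ℝ) := by
      filter_upwards [hgood] with ω hω
      have hfeas : (⋂ i, Z (ω i)).Nonempty := hne _ (by omega) ω fun A => by
        rw [← iInter_subsample]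
        exact ⟨sol (subsample ω A), tieBreak_subset ts _ (by rw [hω A]; rfl)⟩
      have h := card_subsample_violated_le hts hZ hZc (r := r) hK (by omega) sol ω hfeas hω
      rw [← hd] at h
      refine le_trans ?_ ((Nat.cast_le (α := ℝ)).2 h |>.trans (by push_cast; rfl))
      rw [Finset.card_filter, Nat.cast_sum]
      refine Finset.sum_le_sum fun A _ => ?_
      by_cases hA : ω ∈ q A ⁻¹' S
      · have hA' : r < (Finset.univ.filter fun i => sol (subsample ω A) ∉ Z (ω i)).card := by
          refine lt_of_lt_of_le (Set.mem_ofPred_eq ▸ hA) ?_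
          refine Finset.card_le_card_of_injOn
            (A.1ᶜ.orderEmbOfFin (card_compl_of_card_eq A.2)) ?_
            (RelEmbedding.injective _).injOn
          intro j hj
          exact Finset.mem_coe.2 (Finset.mem_filter.2 ⟨Finset.mem_univ _, (Finset.mem_filter.1 hj).2⟩)
        simp [hA, hA']
      · rw [Set.indicator_of_notMem hA]
        positivity
    have hint : ∀ A, Integrable ((q A ⁻¹' S).indicator (1 : (Fin (m + K) → Δ) → ℝ)) P := fun A =>
      (integrable_const (1 : ℝ)).indicator ((hq A).measurable hS)
    have hsum : ∑ A, P.real (q A ⁻¹' S) ≤ ∑ i ∈ Finset.range d, ((r + d).choose i : ℝ) *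
        ((m + K - (r + d)).choose (K - i) : ℝ) := by
      have h := integral_mono_ae (integrable_finsetSum Finset.univ fun A _ => hint A)
        (integrable_const _) hcount
      rw [integral_finsetSum _ fun A _ => hint A, integral_const] at h
      simpa [integral_indicator_one ((hq _).measurable hS)] using h
    have hterm : ∀ A, (1 - 1 / (m * (ε - ε') ^ 2)) * p ≤ P.real (q A ⁻¹' S) := fun A => by
      rw [(hq A).measureReal_preimage hS.nullMeasurableSet]
      exact mul_measureReal_le_measureReal_violatedPairs hZm hsolm hm hε' hr
    have hcard : Fintype.card {A : Finset (Fin (m + K)) // A.card = K} = (m + K).choose K := by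
      simp
    have hpos : (0 : ℝ) < ((m + K).choose K : ℝ) := by
      exact_mod_cast Nat.choose_pos (by omega)
    rw [le_div_iff₀ hpos, mul_comm, ← hcard]
    refine le_trans ?_ hsum
    have := Finset.card_nsmul_le_sum Finset.univ (fun A => P.real (q A ⁻¹' S)) _ fun A _ => hterm A
    simpa using this
  have hlim : ∀ ε' ∈ Set.Ioo 0 ε,
      p ≤ ∑ i ∈ Finset.range d, (K.choose i : ℝ) * ε' ^ i * (1 - ε') ^ (K - i) := by
    intro ε' hε'
    have hε'1 : ε' < 1 := hε'.2.trans hε.2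
    have hleft : Tendsto (fun m : ℕ => (1 - 1 / (m * (ε - ε') ^ 2)) * p) atTop (𝓝 ((1 - 0) * p)) := by
      refine (tendsto_const_nhds.sub ?_).mul_const p
      have : 0 < (ε - ε') ^ 2 := pow_pos (sub_pos.2 hε'.2) 2
      exact tendsto_const_nhds.div_atTop (tendsto_natCast_atTop_atTop.atTop_mul_const this)
    rw [sub_zero, one_mul] at hleft
    refine le_of_tendsto_of_tendsto hleft
      (tendsto_sum_choose_mul_choose_div hK ⟨hε'.1, hε'1⟩) ?_
    filter_upwards [eventually_gt_atTop 0] with m hm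
    have h0 : 0 ≤ ε' * m := mul_nonneg hε'.1.le (Nat.cast_nonneg m)
    exact key m ⌊ε' * m⌋₊ ε' hm hε'.2 (Nat.floor_le h0)
      (Nat.floor_le_of_le (mul_le_of_le_one_left (Nat.cast_nonneg m) hε'1.le))
  have hcont : Continuous fun ε' : ℝ =>
      ∑ i ∈ Finset.range d, (K.choose i : ℝ) * ε' ^ i * (1 - ε') ^ (K - i) := by fun_prop
  refine ge_of_tendsto (hcont.continuousWithinAt (s := Set.Iio ε) (x := ε)) ?_
  filter_upwards [Ioo_mem_nhdsLT hε.1] with ε' hε'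
  exact hlim ε' hε'

end Guarantee

/-! ### Measurability of the selected solution -/

section Measurability

theorem isClosed_setOf_exists_mem_of_isCompact {Θ E : Type*} [TopologicalSpace Θ]
    [TopologicalSpace E] {R : Set (Θ × E)} (hR : IsClosed R) {C : Set E} (hC : IsCompact C) :
    IsClosed {a | ∃ z ∈ C, (a, z) ∈ R} := by
  have : CompactSpace C := isCompact_iff_compactSpace.1 hC
  have hcl : IsClosed ((fun p : Θ × C => (p.1, (p.2 : E))) ⁻¹' R) :=
    hR.preimage (by fun_prop)
  convert isClosedMap_fst_of_compactSpace _ hcl using 1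
  ext a
  simp

/-- The projection of a closed set along a proper metric space is a countable union of closed sets. -/
theorem measurableSet_setOf_exists {Θ E : Type*} [TopologicalSpace Θ] [MeasurableSpace Θ]
    [BorelSpace Θ] [PseudoMetricSpace E] [ProperSpace E] [Nonempty E]
    {R : Set (Θ × E)} (hR : IsClosed R) : MeasurableSet {a | ∃ z, (a, z) ∈ R} := by
  obtain ⟨z₀⟩ := ‹Nonempty E›
  have : {a | ∃ z, (a, z) ∈ R} = ⋃ n : ℕ, {a | ∃ z ∈ Metric.closedBall z₀ n, (a, z) ∈ R} := by
    ext a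
    simp only [Set.mem_iUnion]
    constructor
    · rintro ⟨z, hz⟩
      obtain ⟨n, hn⟩ := exists_nat_ge (dist z z₀)
      exact ⟨n, z, hn, hz⟩
    · rintro ⟨n, z, -, hz⟩
      exact ⟨z, hz⟩
  rw [this]
  exact MeasurableSet.iUnion fun n =>
    (isClosed_setOf_exists_mem_of_isCompact hR (isCompact_closedBall z₀ n)).measurableSet

theorem aemeasurable_of_forall_isClosed {Ω X : Type*} [MeasurableSpace Ω] {ν : Measure Ω}
    [TopologicalSpace X] [MeasurableSpace X] [BorelSpace X] [MeasurableSpace.CountablyGenerated X]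
    {g : Ω → X} (h : ∀ C, IsClosed C → NullMeasurableSet (g ⁻¹' C) ν) : AEMeasurable g ν := by
  refine NullMeasurable.aemeasurable fun s hs => ?_
  have : @Measurable (NullMeasurableSpace Ω ν) X _ _ g := measurable_of_isClosed h
  exact this hs

/-- The point selected by a tie-break rule from a set depending on a parameter through a closed
relation is an almost everywhere measurable function of the parameter. The successive minimal
values are measurable because the projection of a closed set along a `σ`-compact space is. -/
theorem aemeasurable_of_tieBreak {Ω : Type*} [MeasurableSpace Ω] {ν : Measure Ω} {E : Type*}
    [MetricSpace E] [ProperSpace E] [MeasurableSpace E] [BorelSpace E]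
    {ts : List (E → ℝ)} (hts : ∀ t ∈ ts, Continuous t) {Θ : Type*} [TopologicalSpace Θ]
    [MeasurableSpace Θ] [BorelSpace Θ] {R : Set (Θ × E)} (hR : IsClosed R) {θ : Ω → Θ}
    (hθ : AEMeasurable θ ν) {sol : Ω → E}
    (h : ∀ᵐ ω ∂ν, tieBreak ts {z | (θ ω, z) ∈ R} = {sol ω}) : AEMeasurable sol ν := by
  rcases isEmpty_or_nonempty Ω with hΩ | ⟨⟨ω₀⟩⟩
  · exact (measurable_of_empty sol).aemeasurable
  have hE : Nonempty E := ⟨sol ω₀⟩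
  induction ts generalizing Θ with
  | nil =>
    refine aemeasurable_of_forall_isClosed fun C hC => ?_
    have hB := measurableSet_setOf_exists (hR.inter (hC.preimage (continuous_snd (X := Θ))))
    refine (hθ.nullMeasurableSet_preimage hB).congr ?_
    filter_upwards [h] with ω hω
    have hω' : {z | (θ ω, z) ∈ R} = {sol ω} := hω
    have hiff : ∀ z, (θ ω, z) ∈ R ↔ z = sol ω := fun z => by
      rw [← Set.mem_singleton_iff, ← hω']; rfl
    refine propext ?_
    change (∃ z, (θ ω, z) ∈ R ∧ z ∈ C) ↔ sol ω ∈ C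
    simp [hiff]
  | cons t ts ih =>
    have ht : Continuous t := hts t (by simp)
    have hmem : ∀ᵐ ω ∂ν, (θ ω, sol ω) ∈ R ∧ ∀ w, (θ ω, w) ∈ R → t (sol ω) ≤ t w := by
      filter_upwards [h] with ω hω
      have : sol ω ∈ {z ∈ {z | (θ ω, z) ∈ R} | ∀ w ∈ {z | (θ ω, z) ∈ R}, t z ≤ t w} :=
        tieBreak_subset ts _ (by rw [show tieBreak ts _ = {sol ω} from hω]; rfl)
      exact this
    have hv : AEMeasurable (fun ω => t (sol ω)) ν := by
      refine NullMeasurable.aemeasurable fun s hs => ?_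
      have hm : @Measurable (NullMeasurableSpace Ω ν) ℝ _ _ (fun ω => t (sol ω)) := by
        refine measurable_of_Iic fun c => ?_
        have hB := measurableSet_setOf_exists
          (hR.inter (isClosed_le (ht.comp (continuous_snd (X := Θ))) (continuous_const (y := c))))
        refine (hθ.nullMeasurableSet_preimage hB).congr ?_
        filter_upwards [hmem] with ω hω
        refine propext ?_
        change (∃ z, (θ ω, z) ∈ R ∧ t z ≤ c) ↔ t (sol ω) ≤ c
        exact ⟨fun ⟨z, hz, hzc⟩ => (hω.2 z hz).trans hzc, fun hc => ⟨_, hω.1, hc⟩⟩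
      exact hm hs
    have hR' : IsClosed {p : (Θ × ℝ) × E | (p.1.1, p.2) ∈ R ∧ t p.2 ≤ p.1.2} :=
      (hR.preimage (f := fun p : (Θ × ℝ) × E => (p.1.1, p.2)) (by fun_prop)).inter
        (isClosed_le (f := fun p : (Θ × ℝ) × E => t p.2) (g := fun p => p.1.2) (by fun_prop)
          (by fun_prop))
    refine ih (fun s hs => hts s (by simp [hs])) hR' (hθ.prodMk hv) ?_
    filter_upwards [h, hmem] with ω hω hω'
    rw [← show tieBreak ts _ = {sol ω} from hω]
    congr 1
    ext z
    exact and_congr_right fun hz =>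
      ⟨fun hle w hw => hle.trans (hω'.2 w hw), fun hle => hle _ hω'.1⟩

end Measurability

/-! ### Convexity of the storage planning model -/

section Model

theorem comb_le_comb {a b p p' q q' : ℝ} (ha : 0 ≤ a) (hb : 0 ≤ b) (h : p ≤ q) (h' : p' ≤ q') :
    a * p + b * p' ≤ a * q + b * q' :=
  add_le_add (mul_le_mul_of_nonneg_left h ha) (mul_le_mul_of_nonneg_left h' hb)

variable {Bus Gen Line Site : Type*} {H : ℕ}

/-- Componentwise convex combination of two second-stage decisions. -/
def Operation.comb (a b : ℝ) (y y' : Operation Bus Gen Line Site H) :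
    Operation Bus Gen Line Site H where
  ch s t := a * y.ch s t + b * y'.ch s t
  dis s t := a * y.dis s t + b * y'.dis s t
  status s t := a * y.status s t + b * y'.status s t
  soc s t := a * y.soc s t + b * y'.soc s t
  gen i t := a * y.gen i t + b * y'.gen i t
  shed n t := a * y.shed n t + b * y'.shed n t
  flow l t := a * y.flow l t + b * y'.flow l t
  angle n t := a * y.angle n t + b * y'.angle n t

variable [Fintype Site]

theorem investment_comb (D : Network Bus Gen Line Site H) (x x' : Plan Site) (a b : ℝ) :
    investment D (a • x + b • x') = a * investment D x + b * investment D x' := by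
  simp only [investment, Finset.mul_sum, ← Finset.sum_add_distrib, Prod.fst_add, Prod.snd_add,
    Prod.smul_fst, Prod.smul_snd, Pi.add_apply, Pi.smul_apply, smul_eq_mul]
  exact Finset.sum_congr rfl fun s _ => by ring

theorem convex_firstFeasible (D : Network Bus Gen Line Site H) : Convex ℝ (firstFeasible D) := by
  intro x hx x' hx' a b ha hb hab
  refine ⟨?_, fun s => ?_⟩
  · have := comb_le_comb ha hb hx.1 hx'.1
    rw [← add_mul, hab, one_mul] at this
    rwa [investment_comb]
  · have h1 := comb_le_comb ha hb (hx.2 s).1 (hx'.2 s).1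
    have h2 := comb_le_comb ha hb (hx.2 s).2 (hx'.2 s).2
    simp only [Prod.fst_add, Prod.snd_add, Prod.smul_fst, Prod.smul_snd, Pi.add_apply,
      Pi.smul_apply, smul_eq_mul]
    constructor <;> linarith

theorem continuous_investment (D : Network Bus Gen Line Site H) : Continuous (investment D) := by
  unfold investment
  fun_prop

theorem isClosed_firstFeasible (D : Network Bus Gen Line Site H) : IsClosed (firstFeasible D) := by
  have : firstFeasible D = {x | investment D x ≤ D.budget} ∩
      ⋂ s, ({x : Plan Site | D.ratioMin * x.1 s ≤ x.2 s} ∩ {x | x.2 s ≤ D.ratioMax * x.1 s}) := by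
    ext x
    simp [firstFeasible]
  rw [this]
  refine (isClosed_le (continuous_investment D) continuous_const).inter (isClosed_iInter fun s => ?_)
  exact (isClosed_le (by fun_prop) (by fun_prop)).inter (isClosed_le (by fun_prop) (by fun_prop))

theorem secondCost_status [Fintype Bus] [Fintype Gen] (D : Network Bus Gen Line Site H)
    (f : Formulation) (y : Operation Bus Gen Line Site H) (v : Site → Fin H → ℝ) :
    secondCost D f { y with status := v } = secondCost D f y := by
  cases f <;> rfl

theorem secondCost_comb [Fintype Bus] [Fintype Gen] (D : Network Bus Gen Line Site H)
    (f : Formulation) (y y' : Operation Bus Gen Line Site H) (a b : ℝ) :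
    secondCost D f (Operation.comb a b y y') = a * secondCost D f y + b * secondCost D f y' := by
  cases f <;>
  · simp only [secondCost, Operation.comb, mul_add, Finset.sum_add_distrib, mul_left_comm _ a,
      mul_left_comm _ b, ← Finset.mul_sum]
    try ring

variable [DecidableEq Bus] [Fintype Gen] [Fintype Line]

/-- The second-stage constraints with the charging status eliminated: the two capacity constraints
`ch ≤ P v`, `dis ≤ P (1 - v)` with `v ∈ [0, 1]` become the linear constraint `ch + dis ≤ P`. -/
structure IsDispatch (D : Network Bus Gen Line Site H) (x : Plan Site) (δ : Scenario Bus H)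
    (y : Operation Bus Gen Line Site H) : Prop where
  balance : ∀ n t,
    (∑ i with D.genBus i = n, y.gen i t)
      + (∑ s with D.siteBus s = n, y.dis s t) - (∑ s with D.siteBus s = n, y.ch s t)
      + δ.1 n t * D.windCap n
      + (∑ l with D.recvBus l = n, y.flow l t) - (∑ l with D.sendBus l = n, y.flow l t)
      + y.shed n t = δ.2 n t * D.peakLoad n
  gen_bounds : ∀ i t, D.genMin i ≤ y.gen i t ∧ y.gen i t ≤ D.genMax i
  ramp : ∀ i (t' t : Fin H), t'.val + 1 = t.val →
    -D.rampDown i ≤ y.gen i t - y.gen i t' ∧ y.gen i t - y.gen i t' ≤ D.rampUp i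
  line_bounds : ∀ l t, D.lineMin l ≤ y.flow l t ∧ y.flow l t ≤ D.lineMax l
  shed_bounds : ∀ n t, 0 ≤ y.shed n t ∧ y.shed n t ≤ δ.2 n t * D.peakLoad n
  dc_flow : ∀ l t,
    y.flow l t = 1 / D.reactance l * (y.angle (D.sendBus l) t - y.angle (D.recvBus l) t)
  soc_update : ∀ s (t' t : Fin H), t'.val + 1 = t.val →
    y.soc s t - y.soc s t' = y.ch s t * D.effCh s - y.dis s t / D.effDis s
  ch_nonneg : ∀ s t, 0 ≤ y.ch s t
  dis_nonneg : ∀ s t, 0 ≤ y.dis s t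
  ch_add_dis_le : ∀ s t, y.ch s t + y.dis s t ≤ x.2 s
  soc_bounds : ∀ s t, 0 ≤ y.soc s t ∧ y.soc s t ≤ x.1 s

theorem IsOperation.isDispatch {D : Network Bus Gen Line Site H} {x : Plan Site}
    {δ : Scenario Bus H} {y : Operation Bus Gen Line Site H} (h : IsOperation D x δ y) :
    IsDispatch D x δ y :=
  { h with
    ch_nonneg := fun s t => (h.ch_bounds s t).1
    dis_nonneg := fun s t => (h.dis_bounds s t).1
    ch_add_dis_le := fun s t => by
      have := (h.ch_bounds s t).2
      have := (h.dis_bounds s t).2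
      linarith }

theorem IsDispatch.isOperation {D : Network Bus Gen Line Site H} {x : Plan Site}
    {δ : Scenario Bus H} {y : Operation Bus Gen Line Site H} (h : IsDispatch D x δ y) :
    IsOperation D x δ { y with status := fun s t => y.ch s t / x.2 s } where
  balance := h.balance
  gen_bounds := h.gen_bounds
  ramp := h.ramp
  line_bounds := h.line_bounds
  shed_bounds := h.shed_bounds
  dc_flow := h.dc_flow
  soc_update := h.soc_update
  soc_bounds := h.soc_bounds
  ch_bounds := fun s t => by
    have h1 := h.ch_nonneg s t
    have h2 := h.dis_nonneg s t
    have h3 := h.ch_add_dis_le s t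
    refine ⟨h1, ?_⟩
    -- If `P = 0` then `ch = 0`, which is what the quotient by zero gives.
    rcases eq_or_ne (x.2 s) 0 with h0 | h0
    · simp only [h0, zero_mul]; linarith
    · exact (mul_div_cancel₀ _ h0).ge
  dis_bounds := fun s t => by
    have h1 := h.ch_nonneg s t
    have h2 := h.dis_nonneg s t
    have h3 := h.ch_add_dis_le s t
    refine ⟨h2, ?_⟩
    rcases eq_or_ne (x.2 s) 0 with h0 | h0
    · simp only [h0, zero_mul]; linarith
    · rw [mul_sub, mul_one, mul_div_cancel₀ _ h0]; linarith
  status_bounds := fun s t => by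
    have h1 := h.ch_nonneg s t
    have h2 := h.dis_nonneg s t
    have h3 := h.ch_add_dis_le s t
    exact ⟨div_nonneg h1 (by linarith), div_le_one_of_le₀ (by linarith) (by linarith)⟩

theorem IsDispatch.comb {D : Network Bus Gen Line Site H} {x x' : Plan Site}
    {δ : Scenario Bus H} {y y' : Operation Bus Gen Line Site H} (h : IsDispatch D x δ y)
    (h' : IsDispatch D x' δ y') {a b : ℝ} (ha : 0 ≤ a) (hb : 0 ≤ b) (hab : a + b = 1) :
    IsDispatch D (a • x + b • x') δ (Operation.comb a b y y') where
  balance n t := by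
    simp only [Operation.comb, Finset.sum_add_distrib, ← Finset.mul_sum]
    linear_combination a * h.balance n t + b * h'.balance n t +
      (δ.2 n t * D.peakLoad n - δ.1 n t * D.windCap n) * hab
  gen_bounds i t := by
    have h1 := comb_le_comb ha hb (h.gen_bounds i t).1 (h'.gen_bounds i t).1
    have h2 := comb_le_comb ha hb (h.gen_bounds i t).2 (h'.gen_bounds i t).2
    rw [← add_mul, hab, one_mul] at h1 h2
    exact ⟨h1, h2⟩
  ramp i t' t htt := by
    have h1 := comb_le_comb ha hb (h.ramp i t' t htt).1 (h'.ramp i t' t htt).1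
    have h2 := comb_le_comb ha hb (h.ramp i t' t htt).2 (h'.ramp i t' t htt).2
    rw [← add_mul, hab, one_mul] at h1 h2
    simp only [Operation.comb]
    constructor <;> linarith
  line_bounds l t := by
    have h1 := comb_le_comb ha hb (h.line_bounds l t).1 (h'.line_bounds l t).1
    have h2 := comb_le_comb ha hb (h.line_bounds l t).2 (h'.line_bounds l t).2
    rw [← add_mul, hab, one_mul] at h1 h2
    exact ⟨h1, h2⟩
  shed_bounds n t := by
    have h1 := comb_le_comb ha hb (h.shed_bounds n t).1 (h'.shed_bounds n t).1
    have h2 := comb_le_comb ha hb (h.shed_bounds n t).2 (h'.shed_bounds n t).2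
    rw [← add_mul, hab, one_mul] at h1 h2
    exact ⟨h1, h2⟩
  dc_flow l t := by
    simp only [Operation.comb, h.dc_flow l t, h'.dc_flow l t]
    ring
  soc_update s t' t htt := by
    have h1 := h.soc_update s t' t htt
    have h2 := h'.soc_update s t' t htt
    simp only [Operation.comb]
    linear_combination a * h1 + b * h2
  ch_nonneg s t := add_nonneg (mul_nonneg ha (h.ch_nonneg s t)) (mul_nonneg hb (h'.ch_nonneg s t))
  dis_nonneg s t :=
    add_nonneg (mul_nonneg ha (h.dis_nonneg s t)) (mul_nonneg hb (h'.dis_nonneg s t))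
  ch_add_dis_le s t := by
    have h1 := comb_le_comb ha hb (h.ch_add_dis_le s t) (h'.ch_add_dis_le s t)
    simp only [Operation.comb, Prod.snd_add, Prod.smul_snd, Pi.add_apply, Pi.smul_apply,
      smul_eq_mul]
    linarith
  soc_bounds s t :=
    ⟨add_nonneg (mul_nonneg ha (h.soc_bounds s t).1) (mul_nonneg hb (h'.soc_bounds s t).1),
      comb_le_comb ha hb (h.soc_bounds s t).2 (h'.soc_bounds s t).2⟩

variable [Fintype Bus]

theorem mem_acceptable_iff {D : Network Bus Gen Line Site H} {f : Formulation}
    {δ : Scenario Bus H} {z : Plan Site × ℝ} :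
    z ∈ acceptable D f δ ↔ ∃ y, IsDispatch D z.1 δ y ∧ secondCost D f y ≤ z.2 :=
  ⟨fun ⟨y, hy, hc⟩ => ⟨y, hy.isDispatch, hc⟩,
    fun ⟨y, hy, hc⟩ => ⟨_, hy.isOperation, by rwa [secondCost_status]⟩⟩

theorem convex_acceptable (D : Network Bus Gen Line Site H) (f : Formulation)
    (δ : Scenario Bus H) : Convex ℝ (acceptable D f δ) := by
  intro z hz z' hz' a b ha hb hab
  obtain ⟨y, hy, hc⟩ := mem_acceptable_iff.1 hz
  obtain ⟨y', hy', hc'⟩ := mem_acceptable_iff.1 hz'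
  refine mem_acceptable_iff.2 ⟨Operation.comb a b y y', hy.comb hy' ha hb hab, ?_⟩
  rw [secondCost_comb]
  exact comb_le_comb ha hb hc hc'

end Model

/-! ### Closedness and attainment in the second stage -/

section Closedness

theorem isClosed_setOf_exists_of_norm_le {X Y : Type*} [TopologicalSpace X]
    [NormedAddCommGroup Y] [ProperSpace Y] {R : Set (X × Y)} (hR : IsClosed R) {b : X → ℝ}
    (hb : Continuous b) (h : ∀ x y, (x, y) ∈ R → ‖y‖ ≤ b x) : IsClosed {x | ∃ y, (x, y) ∈ R} := by
  refine isClosed_of_closure_subset fun x hx => ?_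
  obtain ⟨n, hn⟩ := exists_gt (b x)
  have hU : IsOpen {x | b x < n} := isOpen_lt hb continuous_const
  have hxU : x ∈ closure ({x | b x < n} ∩ {x | ∃ y, (x, y) ∈ R}) := hU.inter_closure ⟨hn, hx⟩
  have hsub : {x | b x < n} ∩ {x | ∃ y, (x, y) ∈ R} ⊆
      {x | ∃ y ∈ Metric.closedBall (0 : Y) n, (x, y) ∈ R} := by
    rintro w ⟨hw, y, hy⟩
    exact ⟨y, mem_closedBall_zero_iff.2 ((h w y hy).trans (le_of_lt hw)), hy⟩
  obtain ⟨y, -, hy⟩ := closure_minimal hsub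
    (isClosed_setOf_exists_mem_of_isCompact hR (isCompact_closedBall 0 n)) hxU
  exact ⟨y, hy⟩

variable {Bus Gen Line Site : Type*} {H : ℕ}

/-- The components `(ch, dis, soc, gen, shed, flow)` of a second-stage decision, that is all but the
charging status and the voltage angles. -/
abbrev DispatchVector (Bus Gen Line Site : Type*) (H : ℕ) :=
  (Site → Fin H → ℝ) × (Site → Fin H → ℝ) × (Site → Fin H → ℝ) × (Gen → Fin H → ℝ) ×
    (Bus → Fin H → ℝ) × (Line → Fin H → ℝ)

/-- The second-stage decision with given components and voltage angles; the status is set to `0`. -/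
def DispatchVector.toOperation (v : DispatchVector Bus Gen Line Site H) (θ : Bus → Fin H → ℝ) :
    Operation Bus Gen Line Site H where
  ch := v.1
  dis := v.2.1
  status := 0
  soc := v.2.2.1
  gen := v.2.2.2.1
  shed := v.2.2.2.2.1
  flow := v.2.2.2.2.2
  angle := θ

/-- The line flows as a linear function of the voltage angles. -/
noncomputable def flowMap (D : Network Bus Gen Line Site H) :
    (Bus → Fin H → ℝ) →ₗ[ℝ] (Line → Fin H → ℝ) where
  toFun θ l t := 1 / D.reactance l * (θ (D.sendBus l) t - θ (D.recvBus l) t)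
  map_add' θ θ' := by
    ext l t
    simp only [Pi.add_apply]
    ring
  map_smul' c θ := by
    ext l t
    simp only [Pi.smul_apply, smul_eq_mul, RingHom.id_apply]
    ring

variable [Fintype Site]

theorem secondCost_toOperation [Fintype Bus] [Fintype Gen] (D : Network Bus Gen Line Site H)
    (f : Formulation)
    (v : DispatchVector Bus Gen Line Site H) (θ : Bus → Fin H → ℝ) :
    secondCost D f (v.toOperation θ) = secondCost D f (v.toOperation 0) := by
  cases f <;> rfl

theorem continuous_secondCost_toOperation [Fintype Bus] [Fintype Gen]
    (D : Network Bus Gen Line Site H) (f : Formulation) :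
    Continuous fun v : DispatchVector Bus Gen Line Site H => secondCost D f (v.toOperation 0) := by
  cases f <;> simp only [secondCost, DispatchVector.toOperation] <;> fun_prop

variable [DecidableEq Bus] [Fintype Gen] [Fintype Line]

/-- The plans, scenarios and dispatch vectors that can be completed to a feasible second-stage
decision. -/
def dispatchRel (D : Network Bus Gen Line Site H) :
    Set ((Plan Site × Scenario Bus H) × DispatchVector Bus Gen Line Site H) :=
  {p | ∃ θ, IsDispatch D p.1.1 p.1.2 (p.2.toOperation θ)}

/-- The second-stage feasible set depends on plan and scenario through a closed relation. All the
constraints but one are closed conditions not involving the angles, and the flows that some angles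
induce form a linear subspace. -/
theorem isClosed_dispatchRel (D : Network Bus Gen Line Site H) : IsClosed (dispatchRel D) := by
  refine isClosed_of_closure_subset fun p hp => ?_
  have hflow : p.2.2.2.2.2.2 ∈ LinearMap.range (flowMap D) := by
    refine closure_minimal (s := dispatchRel D)
      (t := (fun q : (Plan Site × Scenario Bus H) × DispatchVector Bus Gen Line Site H =>
        q.2.2.2.2.2.2) ⁻¹' (LinearMap.range (flowMap D) : Set (Line → Fin H → ℝ))) ?_ ?_ hp
    · rintro q ⟨θ, hθ⟩
      refine ⟨θ, ?_⟩
      ext l t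
      exact (hθ.dc_flow l t).symm
    · exact (Submodule.closed_of_finiteDimensional _).preimage (by fun_prop)
  obtain ⟨θ, hθ⟩ := hflow
  refine ⟨θ, ?_⟩
  have hle {f g : (Plan Site × Scenario Bus H) × DispatchVector Bus Gen Line Site H → ℝ}
      (hf : Continuous f) (hg : Continuous g) (h : ∀ q ∈ dispatchRel D, f q ≤ g q) : f p ≤ g p :=
    closure_minimal (t := {q | f q ≤ g q}) h (isClosed_le hf hg) hp
  have heq {f g : (Plan Site × Scenario Bus H) × DispatchVector Bus Gen Line Site H → ℝ}
      (hf : Continuous f) (hg : Continuous g) (h : ∀ q ∈ dispatchRel D, f q = g q) : f p = g p :=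
    closure_minimal (t := {q | f q = g q}) h (isClosed_eq hf hg) hp
  exact
    { balance := fun n t => heq
        (f := fun q => (∑ i with D.genBus i = n, q.2.2.2.2.1 i t)
          + (∑ s with D.siteBus s = n, q.2.2.1 s t) - (∑ s with D.siteBus s = n, q.2.1 s t)
          + q.1.2.1 n t * D.windCap n
          + (∑ l with D.recvBus l = n, q.2.2.2.2.2.2 l t)
          - (∑ l with D.sendBus l = n, q.2.2.2.2.2.2 l t)
          + q.2.2.2.2.2.1 n t) (g := fun q => q.1.2.2 n t * D.peakLoad n)
        (by fun_prop) (by fun_prop) (fun _ ⟨_, hq⟩ => hq.balance n t)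
      gen_bounds := fun i t =>
        ⟨hle (f := fun _ => D.genMin i) (g := fun q => q.2.2.2.2.1 i t)
          (by fun_prop) (by fun_prop) (fun _ ⟨_, hq⟩ => (hq.gen_bounds i t).1),
        hle (f := fun q => q.2.2.2.2.1 i t) (g := fun _ => D.genMax i)
          (by fun_prop) (by fun_prop) (fun _ ⟨_, hq⟩ => (hq.gen_bounds i t).2)⟩
      ramp := fun i t' t htt =>
        ⟨hle (f := fun _ => -D.rampDown i)
          (g := fun q => q.2.2.2.2.1 i t - q.2.2.2.2.1 i t')
          (by fun_prop) (by fun_prop) (fun _ ⟨_, hq⟩ => (hq.ramp i t' t htt).1),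
        hle (f := fun q => q.2.2.2.2.1 i t - q.2.2.2.2.1 i t')
          (g := fun _ => D.rampUp i)
          (by fun_prop) (by fun_prop) (fun _ ⟨_, hq⟩ => (hq.ramp i t' t htt).2)⟩
      line_bounds := fun l t =>
        ⟨hle (f := fun _ => D.lineMin l) (g := fun q => q.2.2.2.2.2.2 l t)
          (by fun_prop) (by fun_prop) (fun _ ⟨_, hq⟩ => (hq.line_bounds l t).1),
        hle (f := fun q => q.2.2.2.2.2.2 l t) (g := fun _ => D.lineMax l)
          (by fun_prop) (by fun_prop) (fun _ ⟨_, hq⟩ => (hq.line_bounds l t).2)⟩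
      shed_bounds := fun n t =>
        ⟨hle (f := fun _ => 0) (g := fun q => q.2.2.2.2.2.1 n t)
          (by fun_prop) (by fun_prop) (fun _ ⟨_, hq⟩ => (hq.shed_bounds n t).1),
        hle (f := fun q => q.2.2.2.2.2.1 n t)
          (g := fun q => q.1.2.2 n t * D.peakLoad n)
          (by fun_prop) (by fun_prop) (fun _ ⟨_, hq⟩ => (hq.shed_bounds n t).2)⟩
      dc_flow := fun l t => (congrFun (congrFun hθ l) t).symm
      soc_update := fun s t' t htt => heq
        (f := fun q => q.2.2.2.1 s t - q.2.2.2.1 s t')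
        (g := fun q => q.2.1 s t * D.effCh s - q.2.2.1 s t / D.effDis s)
        (by fun_prop) (by fun_prop) (fun _ ⟨_, hq⟩ => hq.soc_update s t' t htt)
      ch_nonneg := fun s t => hle (f := fun _ => 0) (g := fun q => q.2.1 s t)
          (by fun_prop) (by fun_prop) (fun _ ⟨_, hq⟩ => hq.ch_nonneg s t)
      dis_nonneg := fun s t => hle (f := fun _ => 0) (g := fun q => q.2.2.1 s t)
          (by fun_prop) (by fun_prop) (fun _ ⟨_, hq⟩ => hq.dis_nonneg s t)
      ch_add_dis_le := fun s t => hle (f := fun q => q.2.1 s t + q.2.2.1 s t)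
          (g := fun q => q.1.1.2 s)
          (by fun_prop) (by fun_prop) (fun _ ⟨_, hq⟩ => hq.ch_add_dis_le s t)
      soc_bounds := fun s t =>
        ⟨hle (f := fun _ => 0) (g := fun q => q.2.2.2.1 s t)
          (by fun_prop) (by fun_prop) (fun _ ⟨_, hq⟩ => (hq.soc_bounds s t).1),
        hle (f := fun q => q.2.2.2.1 s t) (g := fun q => q.1.1.1 s)
          (by fun_prop) (by fun_prop) (fun _ ⟨_, hq⟩ => (hq.soc_bounds s t).2)⟩ }

variable [Fintype Bus]

/-- A bound on the components of a feasible second-stage decision. -/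
noncomputable def dispatchBound (D : Network Bus Gen Line Site H)
    (q : Plan Site × Scenario Bus H) : ℝ :=
  ‖q.1‖ + ‖q.2‖ * ‖D.peakLoad‖ + (‖D.genMin‖ + ‖D.genMax‖) + (‖D.lineMin‖ + ‖D.lineMax‖)

theorem norm_pi_pi_le {α : Type*} [Fintype α] {u : α → Fin H → ℝ} {c : ℝ} (hc : 0 ≤ c)
    (h : ∀ a t, |u a t| ≤ c) : ‖u‖ ≤ c :=
  (pi_norm_le_iff_of_nonneg hc).2 fun a => (pi_norm_le_iff_of_nonneg hc).2 fun t => h a t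

theorem abs_le_norm_add_norm {α : Type*} [Fintype α] (lo hi : α → ℝ) (a : α) (r : ℝ)
    (hlo : lo a ≤ r) (hhi : r ≤ hi a) : |r| ≤ ‖lo‖ + ‖hi‖ := by
  have h1 := norm_le_pi_norm lo a
  have h2 := norm_le_pi_norm hi a
  rw [Real.norm_eq_abs] at h1 h2
  have := neg_abs_le (lo a)
  have := le_abs_self (hi a)
  have := norm_nonneg lo
  have := norm_nonneg hi
  exact abs_le.2 ⟨by linarith, by linarith⟩

theorem norm_le_dispatchBound {D : Network Bus Gen Line Site H} {q : Plan Site × Scenario Bus H}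
    {v : DispatchVector Bus Gen Line Site H} (h : (q, v) ∈ dispatchRel D) :
    ‖v‖ ≤ dispatchBound D q := by
  obtain ⟨θ, hθ⟩ := h
  have h1 := norm_nonneg q.1
  have h2 : 0 ≤ ‖q.2‖ * ‖D.peakLoad‖ := by positivity
  have h3 := norm_nonneg D.genMin
  have h4 := norm_nonneg D.genMax
  have h5 := norm_nonneg D.lineMin
  have h6 := norm_nonneg D.lineMax
  have hE : ∀ s, q.1.1 s ≤ ‖q.1‖ := fun s =>
    (le_abs_self _).trans ((norm_le_pi_norm q.1.1 s).trans (norm_fst_le q.1))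
  have hP : ∀ s, q.1.2 s ≤ ‖q.1‖ := fun s =>
    (le_abs_self _).trans ((norm_le_pi_norm q.1.2 s).trans (norm_snd_le q.1))
  have hd : ∀ n t, q.2.2 n t * D.peakLoad n ≤ ‖q.2‖ * ‖D.peakLoad‖ := fun n t => by
    refine (le_abs_self _).trans ?_
    rw [abs_mul]
    exact mul_le_mul (((norm_le_pi_norm (q.2.2 n) t).trans (norm_le_pi_norm q.2.2 n)).trans
      (norm_snd_le q.2)) (norm_le_pi_norm D.peakLoad n) (abs_nonneg _) (norm_nonneg _)
  have hB : 0 ≤ dispatchBound D q := by unfold dispatchBound; positivity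
  refine norm_prod_le_iff.2 ⟨norm_pi_pi_le hB fun s t => ?_, norm_prod_le_iff.2
    ⟨norm_pi_pi_le hB fun s t => ?_, norm_prod_le_iff.2 ⟨norm_pi_pi_le hB fun s t => ?_,
      norm_prod_le_iff.2 ⟨norm_pi_pi_le hB fun i t => ?_, norm_prod_le_iff.2
        ⟨norm_pi_pi_le hB fun n t => ?_, norm_pi_pi_le hB fun l t => ?_⟩⟩⟩⟩⟩
  · have a1 : 0 ≤ v.1 s t := hθ.ch_nonneg s t
    have a2 : 0 ≤ v.2.1 s t := hθ.dis_nonneg s t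
    have a3 : v.1 s t + v.2.1 s t ≤ q.1.2 s := hθ.ch_add_dis_le s t
    have := hP s
    rw [abs_of_nonneg a1, dispatchBound]
    linarith
  · have a1 : 0 ≤ v.1 s t := hθ.ch_nonneg s t
    have a2 : 0 ≤ v.2.1 s t := hθ.dis_nonneg s t
    have a3 : v.1 s t + v.2.1 s t ≤ q.1.2 s := hθ.ch_add_dis_le s t
    have := hP s
    rw [abs_of_nonneg a2, dispatchBound]
    linarith
  · have a1 : 0 ≤ v.2.2.1 s t := (hθ.soc_bounds s t).1
    have a2 : v.2.2.1 s t ≤ q.1.1 s := (hθ.soc_bounds s t).2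
    have := hE s
    rw [abs_of_nonneg a1, dispatchBound]
    linarith
  · have := abs_le_norm_add_norm D.genMin D.genMax i (v.2.2.2.1 i t) (hθ.gen_bounds i t).1 (hθ.gen_bounds i t).2
    rw [dispatchBound]
    linarith
  · have a1 : 0 ≤ v.2.2.2.2.1 n t := (hθ.shed_bounds n t).1
    have a2 : v.2.2.2.2.1 n t ≤ q.2.2 n t * D.peakLoad n := (hθ.shed_bounds n t).2
    have := hd n t
    rw [abs_of_nonneg a1, dispatchBound]
    linarith
  · have := abs_le_norm_add_norm D.lineMin D.lineMax l (v.2.2.2.2.2 l t) (hθ.line_bounds l t).1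
      (hθ.line_bounds l t).2
    rw [dispatchBound]
    linarith

theorem IsDispatch.exists_toOperation {D : Network Bus Gen Line Site H} {x : Plan Site}
    {δ : Scenario Bus H} {y : Operation Bus Gen Line Site H} (h : IsDispatch D x δ y)
    (f : Formulation) :
    ∃ v, ((x, δ), v) ∈ dispatchRel D ∧ secondCost D f (v.toOperation 0) = secondCost D f y := by
  refine ⟨(y.ch, y.dis, y.soc, y.gen, y.shed, y.flow), ⟨y.angle, ?_⟩, by cases f <;> rfl⟩
  exact ⟨h.balance, h.gen_bounds, h.ramp, h.line_bounds, h.shed_bounds, h.dc_flow, h.soc_update,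
    h.ch_nonneg, h.dis_nonneg, h.ch_add_dis_le, h.soc_bounds⟩

theorem mem_acceptable_iff_exists_dispatchRel {D : Network Bus Gen Line Site H} {f : Formulation}
    {δ : Scenario Bus H} {z : Plan Site × ℝ} :
    z ∈ acceptable D f δ ↔
      ∃ v, ((z.1, δ), v) ∈ dispatchRel D ∧ secondCost D f (v.toOperation 0) ≤ z.2 := by
  rw [mem_acceptable_iff]
  constructor
  · rintro ⟨y, hy, hc⟩
    obtain ⟨v, hv, hvc⟩ := hy.exists_toOperation f
    exact ⟨v, hv, hvc.trans_le hc⟩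
  · rintro ⟨v, ⟨θ, hθ⟩, hc⟩
    exact ⟨_, hθ, by rwa [secondCost_toOperation]⟩

theorem isClosed_setOf_mem_acceptable (D : Network Bus Gen Line Site H) (f : Formulation) :
    IsClosed {p : (Plan Site × ℝ) × Scenario Bus H | p.1 ∈ acceptable D f p.2} := by
  have hR : IsClosed {r : ((Plan Site × ℝ) × Scenario Bus H) × DispatchVector Bus Gen Line Site H |
      ((r.1.1.1, r.1.2), r.2) ∈ dispatchRel D ∧ secondCost D f (r.2.toOperation 0) ≤ r.1.1.2} :=
    ((isClosed_dispatchRel D).preimage (f := fun r :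
      ((Plan Site × ℝ) × Scenario Bus H) × DispatchVector Bus Gen Line Site H =>
        ((r.1.1.1, r.1.2), r.2)) (by fun_prop)).inter
      (isClosed_le ((continuous_secondCost_toOperation D f).comp continuous_snd)
        (g := fun r : ((Plan Site × ℝ) × Scenario Bus H) × DispatchVector Bus Gen Line Site H =>
          r.1.1.2) (by fun_prop))
  have hb : Continuous fun p : (Plan Site × ℝ) × Scenario Bus H => dispatchBound D (p.1.1, p.2) := by
    unfold dispatchBound
    fun_prop
  have := isClosed_setOf_exists_of_norm_le hR hb fun p v hv => norm_le_dispatchBound hv.1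
  convert this using 1
  ext p
  exact mem_acceptable_iff_exists_dispatchRel

/-- A feasible second stage has an optimal solution. -/
theorem recourse_eq_top_or_exists (D : Network Bus Gen Line Site H) (f : Formulation)
    (x : Plan Site) (δ : Scenario Bus H) :
    recourse D f x δ = ⊤ ∨ ∃ y, IsOperation D x δ y ∧ (secondCost D f y : EReal) ≤ recourse D f x δ := by
  set S := {v | ((x, δ), v) ∈ dispatchRel D} with hS
  have hSc : IsCompact S := by
    refine (isCompact_closedBall (0 : DispatchVector Bus Gen Line Site H)
      (dispatchBound D (x, δ))).of_isClosed_subset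
        ((isClosed_dispatchRel D).preimage (by fun_prop)) fun v hv => ?_
    exact mem_closedBall_zero_iff.2 (norm_le_dispatchBound hv)
  rcases S.eq_empty_or_nonempty with he | hne
  · refine Or.inl ?_
    rw [recourse, iInf₂_eq_top]
    intro y hy
    obtain ⟨v, hv, -⟩ := hy.isDispatch.exists_toOperation f
    exact (he.subset hv : v ∈ (∅ : Set _)).elim
  · refine Or.inr ?_
    obtain ⟨v, ⟨θ, hθ⟩, hmin⟩ :=
      hSc.exists_isMinOn hne (continuous_secondCost_toOperation D f).continuousOn
    refine ⟨_, hθ.isOperation, le_iInf₂ fun y hy => ?_⟩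
    obtain ⟨v', hv', hc⟩ := hy.isDispatch.exists_toOperation f
    rw [secondCost_status, secondCost_toOperation, ← hc]
    exact_mod_cast isMinOn_iff.1 hmin v' hv'

theorem recourse_le_iff {D : Network Bus Gen Line Site H} {f : Formulation} {x : Plan Site}
    {δ : Scenario Bus H} {γ : ℝ} : recourse D f x δ ≤ γ ↔ (x, γ) ∈ acceptable D f δ := by
  constructor
  · intro h
    rcases recourse_eq_top_or_exists D f x δ with ht | ⟨y, hy, hc⟩
    · rw [ht] at h
      exact (EReal.coe_ne_top γ (top_le_iff.1 h)).elim
    · exact ⟨y, hy, by exact_mod_cast hc.trans h⟩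
  · rintro ⟨y, hy, hc⟩
    exact (iInf₂_le y hy).trans (by exact_mod_cast hc)

theorem recourse_ne_bot (D : Network Bus Gen Line Site H) (f : Formulation) (x : Plan Site)
    (δ : Scenario Bus H) : recourse D f x δ ≠ ⊥ := by
  intro h
  rcases recourse_eq_top_or_exists D f x δ with ht | ⟨y, -, hc⟩
  · simp [ht] at h
  · rw [h] at hc
    exact EReal.coe_ne_bot _ (le_bot_iff.1 hc)

end Closedness

/-! ### The storage planning problem as a sampled convex program -/

section Program

variable {Bus Gen Line Site : Type*} [Fintype Site] {H : ℕ}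

/-- The objective of the robust problem in epigraph form. -/
def epigraphCost (D : Network Bus Gen Line Site H) (f : Formulation) (z : Plan Site × ℝ) : ℝ :=
  firstCost D f z.1 + D.weight * z.2

theorem convexOn_epigraphCost (D : Network Bus Gen Line Site H) (f : Formulation) :
    ConvexOn ℝ Set.univ (epigraphCost D f) := by
  refine ⟨convex_univ, fun z _ z' _ a b _ _ _ => le_of_eq ?_⟩
  cases f
  · simp only [epigraphCost, firstCost, Prod.fst_add, Prod.snd_add, Prod.smul_fst, Prod.smul_snd,
      smul_eq_mul, investment_comb]
    ring
  · simp only [epigraphCost, firstCost, Prod.snd_add, Prod.smul_snd, smul_eq_mul]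
    ring

variable [Fintype Bus] [DecidableEq Bus] [Fintype Gen] [Fintype Line]

/-- The pairs `(x, γ)` of a feasible plan and a cost at which the scenario `δ` can be operated. -/
def scenarioSet (D : Network Bus Gen Line Site H) (f : Formulation) (δ : Scenario Bus H) :
    Set (Plan Site × ℝ) :=
  {z | z.1 ∈ firstFeasible D ∧ z ∈ acceptable D f δ}

theorem convex_scenarioSet (D : Network Bus Gen Line Site H) (f : Formulation)
    (δ : Scenario Bus H) : Convex ℝ (scenarioSet D f δ) :=
  ((convex_firstFeasible D).linear_preimage (LinearMap.fst ℝ (Plan Site) ℝ)).inter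
    (convex_acceptable D f δ)

theorem isClosed_setOf_mem_scenarioSet (D : Network Bus Gen Line Site H) (f : Formulation) :
    IsClosed {p : (Plan Site × ℝ) × Scenario Bus H | p.1 ∈ scenarioSet D f p.2} :=
  ((isClosed_firstFeasible D).preimage (f := fun p : (Plan Site × ℝ) × Scenario Bus H => p.1.1)
    (by fun_prop)).inter (isClosed_setOf_mem_acceptable D f)

theorem mem_scenarioSet_of_le {D : Network Bus Gen Line Site H} {f : Formulation}
    {δ : Scenario Bus H} {x : Plan Site} {γ γ' : ℝ} (h : (x, γ) ∈ scenarioSet D f δ)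
    (hγ : γ ≤ γ') : (x, γ') ∈ scenarioSet D f δ := by
  obtain ⟨hx, y, hy, hc⟩ := h
  exact ⟨hx, y, hy, hc.trans hγ⟩

theorem worstRecourse_le_iff {D : Network Bus Gen Line Site H} {f : Formulation} {K : ℕ}
    {ω : Fin K → Scenario Bus H} {x : Plan Site} (hx : x ∈ firstFeasible D) {γ : ℝ} :
    worstRecourse D f ω x ≤ γ ↔ (x, γ) ∈ ⋂ k, scenarioSet D f (ω k) := by
  rw [worstRecourse, iSup_le_iff, Set.mem_iInter]
  exact forall_congr' fun k => recourse_le_iff.trans ⟨fun h => ⟨hx, h⟩, fun h => h.2⟩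

theorem worstRecourse_ne_bot (D : Network Bus Gen Line Site H) (f : Formulation) {K : ℕ}
    (hK : 0 < K) (ω : Fin K → Scenario Bus H) (x : Plan Site) : worstRecourse D f ω x ≠ ⊥ := by
  intro h
  exact recourse_ne_bot D f x (ω ⟨0, hK⟩)
    (le_bot_iff.1 (h ▸ le_iSup (fun k => recourse D f x (ω k)) ⟨0, hK⟩))

theorem robustCost_eq_of_worstRecourse_eq {D : Network Bus Gen Line Site H} {f : Formulation}
    {K : ℕ} {ω : Fin K → Scenario Bus H} {x : Plan Site} {γ : ℝ}
    (h : worstRecourse D f ω x = γ) : robustCost D f ω x = epigraphCost D f (x, γ) := by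
  rw [robustCost, h, epigraphCost]
  push_cast
  rfl

/-- The two-stage robust problem in epigraph form. -/
theorem optimalSolutions_eq (D : Network Bus Gen Line Site H) (f : Formulation) {K : ℕ}
    (hK : 0 < K) (ω : Fin K → Scenario Bus H) :
    optimalSolutions D f ω = {z ∈ ⋂ k, scenarioSet D f (ω k) |
      ∀ w ∈ ⋂ k, scenarioSet D f (ω k), epigraphCost D f z ≤ epigraphCost D f w} := by
  have hcase : ∀ x, worstRecourse D f ω x = ⊤ ∨ ∃ g : ℝ, worstRecourse D f ω x = g := fun x => by
    induction h : worstRecourse D f ω x with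
    | bot => exact (worstRecourse_ne_bot D f hK ω x h).elim
    | coe g => exact Or.inr ⟨g, rfl⟩
    | top => exact Or.inl rfl
  have hfirst : ∀ w ∈ ⋂ k, scenarioSet D f (ω k), w.1 ∈ firstFeasible D := fun w hw =>
    (Set.mem_iInter.1 hw ⟨0, hK⟩).1
  -- At a point of the intersection the worst-case cost is a real number below the last coordinate.
  have hreal : ∀ w ∈ ⋂ k, scenarioSet D f (ω k), ∃ g : ℝ, worstRecourse D f ω w.1 = g ∧ g ≤ w.2 := by
    intro w hw
    have hle := (worstRecourse_le_iff (hfirst w hw)).2 hw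
    rcases hcase w.1 with h | ⟨g, hg⟩
    · rw [h] at hle
      exact (EReal.coe_ne_top _ (top_le_iff.1 hle)).elim
    · exact ⟨g, hg, by rw [hg] at hle; exact_mod_cast hle⟩
  ext ⟨x, γ⟩
  constructor
  · rintro ⟨hx, hmin, hγ⟩
    refine ⟨(worstRecourse_le_iff hx).1 hγ.ge, fun w hw => ?_⟩
    obtain ⟨g, hg, hgw⟩ := hreal w hw
    have h := hmin w.1 (hfirst w hw)
    rw [robustCost_eq_of_worstRecourse_eq hγ.symm, robustCost_eq_of_worstRecourse_eq hg] at h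
    refine (EReal.coe_le_coe_iff.1 h).trans ?_
    exact add_le_add le_rfl (mul_le_mul_of_nonneg_left hgw D.weight_pos.le)
  · rintro ⟨hz, hmin⟩
    have hx : x ∈ firstFeasible D := hfirst _ hz
    obtain ⟨g, hg, hgγ⟩ := hreal _ hz
    have h := hmin (x, g) ((worstRecourse_le_iff hx).1 hg.le)
    have hγg : γ = g := by
      refine le_antisymm ?_ hgγ
      exact le_of_mul_le_mul_left (le_of_add_le_add_left h) D.weight_pos
    subst hγg
    refine ⟨hx, fun x' hx' => ?_, hg.symm⟩
    rcases hcase x' with h' | ⟨g', hg'⟩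
    · have : robustCost D f ω x' = ⊤ := by
        rw [robustCost, h', EReal.coe_mul_top_of_pos D.weight_pos, EReal.coe_add_top]
      rw [this]
      exact le_top
    · rw [robustCost_eq_of_worstRecourse_eq hg, robustCost_eq_of_worstRecourse_eq hg']
      exact EReal.coe_le_coe_iff.2 (hmin (x', g') ((worstRecourse_le_iff hx').1 hg'.le))

theorem finrank_plan (Site : Type*) [Fintype Site] :
    Module.finrank ℝ (Plan Site) = 2 * Fintype.card Site := by
  rw [Module.finrank_prod, Module.finrank_fintype_fun_eq_card, two_mul]

/-- The scenario sets are closed under increasing the last coordinate, so Helly's theorem applies to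
their projections to the space of plans, which has one dimension less. -/
theorem nonempty_iInter_scenarioSet (D : Network Bus Gen Line Site H) (f : Formulation) {N K : ℕ}
    (hK : 2 * Fintype.card Site + 1 ≤ K) (hKN : K ≤ N) (ω : Fin N → Scenario Bus H)
    (h : ∀ A : {A : Finset (Fin N) // A.card = K}, (⋂ i ∈ A.1, scenarioSet D f (ω i)).Nonempty) :
    (⋂ i, scenarioSet D f (ω i)).Nonempty := by
  classical
  have hx : (⋂ i ∈ (Finset.univ : Finset (Fin N)),
      Prod.fst '' scenarioSet D f (ω i)).Nonempty := by
    refine Convex.helly_theorem' (𝕜 := ℝ) (fun i _ => ?_) fun I _ hI => ?_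
    · exact (convex_scenarioSet D f (ω i)).is_linear_image (LinearMap.fst ℝ (Plan Site) ℝ).isLinear
    · rw [finrank_plan] at hI
      obtain ⟨A, hIA, -, hA⟩ := Finset.exists_subsuperset_card_eq (Finset.subset_univ I)
        (hI.trans hK) (by simpa using hKN)
      obtain ⟨z, hz⟩ := h ⟨A, hA⟩
      exact ⟨z.1, Set.mem_iInter₂.2 fun i hi =>
        ⟨z, Set.mem_iInter₂.1 hz i (hIA hi), rfl⟩⟩
  obtain ⟨x, hx⟩ := hx
  have hγ : ∀ i, ∃ γ : ℝ, (x, γ) ∈ scenarioSet D f (ω i) := fun i => by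
    obtain ⟨⟨x', γ⟩, hz, rfl⟩ := Set.mem_iInter₂.1 hx i (Finset.mem_univ i)
    exact ⟨γ, hz⟩
  choose γ hγ using hγ
  obtain ⟨M, hM⟩ := (Set.finite_range γ).bddAbove
  exact ⟨(x, M), Set.mem_iInter.2 fun i => mem_scenarioSet_of_le (hγ i) (hM ⟨i, rfl⟩)⟩

theorem lt_of_sum_binomial_lt_one {ε : ℝ} (hε : ε ∈ Set.Ioo (0 : ℝ) 1) {n K : ℕ}
    (h : ∑ i ∈ Finset.range (n + 1), (K.choose i : ℝ) * ε ^ i * (1 - ε) ^ (K - i) < 1) :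
    n < K := by
  by_contra! hKn
  have h1 : ∑ i ∈ Finset.range (K + 1), (K.choose i : ℝ) * ε ^ i * (1 - ε) ^ (K - i) = 1 := by
    have := add_pow ε (1 - ε) K
    rw [add_sub_cancel, one_pow] at this
    exact (Finset.sum_congr rfl fun i _ => by ring).trans this.symm
  have h2 := Finset.sum_le_sum_of_subset_of_nonneg
    (f := fun i => (K.choose i : ℝ) * ε ^ i * (1 - ε) ^ (K - i))
    (Finset.range_mono (by omega : K + 1 ≤ n + 1)) fun i _ _ => by
      have := hε.1.le
      have := sub_nonneg.2 hε.2.le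
      positivity
  linarith

/-- The binomial tail bound for the storage planning problem. -/
theorem measureReal_lt_violation_sol_le (D : Network Bus Gen Line Site H) (f : Formulation)
    (μ : Measure (Scenario Bus H)) [IsProbabilityMeasure μ] {ε : ℝ} (hε : ε ∈ Set.Ioo (0 : ℝ) 1)
    {K : ℕ} (hK : 2 * Fintype.card Site + 1 ≤ K) {rule : List (Plan Site × ℝ → ℝ)}
    (hrule : ∀ t ∈ rule, ConvexOn ℝ Set.univ t) {sol : (Fin K → Scenario Bus H) → Plan Site × ℝ}
    (hsol : ∀ᵐ ω ∂Measure.pi (fun _ : Fin K => μ),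
      tieBreak rule (optimalSolutions D f ω) = {sol ω}) :
    (Measure.pi (fun _ : Fin K => μ)).real {ω | ε < violation D f μ (sol ω)} ≤
      ∑ i ∈ Finset.range (2 * Fintype.card Site + 1),
        (K.choose i : ℝ) * ε ^ i * (1 - ε) ^ (K - i) := by
  have hK0 : 0 < K := by omega
  have hdim : Module.finrank ℝ (Plan Site × ℝ) = 2 * Fintype.card Site + 1 := by
    rw [Module.finrank_prod, finrank_plan, Module.finrank_self]
  have hts : ∀ t ∈ epigraphCost D f :: rule, ConvexOn ℝ Set.univ t := by
    simpa using ⟨convexOn_epigraphCost D f, hrule⟩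
  have hsol' : ∀ᵐ ω ∂Measure.pi (fun _ : Fin K => μ),
      tieBreak (epigraphCost D f :: rule) (⋂ k, scenarioSet D f (ω k)) = {sol ω} := by
    filter_upwards [hsol] with ω hω
    rw [optimalSolutions_eq D f hK0 ω] at hω
    exact hω
  have hcl := isClosed_setOf_mem_scenarioSet D f
  have hclosed : ∀ δ, IsClosed (scenarioSet D f δ) := fun δ =>
    hcl.preimage (f := fun z : Plan Site × ℝ => (z, δ)) (by fun_prop)
  have hrel : IsClosed {p : (Fin K → Scenario Bus H) × (Plan Site × ℝ) |
      p.2 ∈ ⋂ k, scenarioSet D f (p.1 k)} := by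
    have : {p : (Fin K → Scenario Bus H) × (Plan Site × ℝ) |
        p.2 ∈ ⋂ k, scenarioSet D f (p.1 k)} = ⋂ k, (fun p => (p.2, p.1 k)) ⁻¹'
          {p : (Plan Site × ℝ) × Scenario Bus H | p.1 ∈ scenarioSet D f p.2} := by
      ext p
      simp
    rw [this]
    exact isClosed_iInter fun k => hcl.preimage (by fun_prop)
  have : BorelSpace (Fin K → Scenario Bus H) := Pi.borelSpace
  have hmeas : AEMeasurable sol (Measure.pi fun _ : Fin K => μ) :=
    aemeasurable_of_tieBreak (fun t ht => continuous_of_convexOn_univ (hts t ht)) hrel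
      aemeasurable_id hsol'
  have hmk : ∀ᵐ ω ∂Measure.pi (fun _ : Fin K => μ),
      tieBreak (epigraphCost D f :: rule) (⋂ k, scenarioSet D f (ω k)) = {hmeas.mk sol ω} := by
    filter_upwards [hsol', hmeas.ae_eq_mk] with ω hω heq
    rw [hω, heq]
  have hbound := measureReal_lt_violation_le hts (convex_scenarioSet D f) hclosed
    hcl.measurableSet (hdim.trans_le hK)
    (fun N hN ω h => nonempty_iInter_scenarioSet D f hK hN ω h) hmeas.measurable_mk hmk hε
  rw [hdim] at hbound
  refine le_of_eq_of_le (measureReal_congr ?_) hbound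
  filter_upwards [hsol', hmeas.ae_eq_mk] with ω hω heq
  have hmem : sol ω ∈ ⋂ k, scenarioSet D f (ω k) :=
    tieBreak_subset (epigraphCost D f :: rule) _ (by rw [hω]; rfl)
  have hfirst : (sol ω).1 ∈ firstFeasible D := (Set.mem_iInter.1 hmem ⟨0, hK0⟩).1
  have hviol : violation D f μ (sol ω) = μ.real {δ | hmeas.mk sol ω ∉ scenarioSet D f δ} := by
    rw [← heq, violation]
    congr 1
    ext δ
    exact not_congr ⟨fun h => ⟨hfirst, h⟩, fun h => h.2⟩
  refine propext ?_
  change ε < _ ↔ ε < _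
  rw [hviol]

end Program

end StoragePlanning

theorem mainTheorem1 {Bus Gen Line Site : Type*} [Fintype Bus] [DecidableEq Bus] [Fintype Gen]
    [Fintype Line] [Fintype Site] {H : ℕ}
    (D : StoragePlanning.Network Bus Gen Line Site H) (f : StoragePlanning.Formulation)
    (μ : Measure (StoragePlanning.Scenario Bus H)) [IsProbabilityMeasure μ]
    (ε β : ℝ) (hε : ε ∈ Set.Ioo (0 : ℝ) 1) (hβ : β ∈ Set.Ioo (0 : ℝ) 1)
    (K : ℕ)
    (hK : IsLeast {N : ℕ | ∑ i ∈ Finset.range (2 * Fintype.card Site + 1),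
      (N.choose i : ℝ) * ε ^ i * (1 - ε) ^ (N - i) ≤ β} K)
    (rule : List (StoragePlanning.Plan Site × ℝ → ℝ))
    (hrule : ∀ t ∈ rule, ConvexOn ℝ Set.univ t)
    (sol : (Fin K → StoragePlanning.Scenario Bus H) → StoragePlanning.Plan Site × ℝ)
    (hsol : ∀ᵐ ω ∂Measure.pi (fun _ : Fin K => μ),
      StoragePlanning.tieBreak rule (StoragePlanning.optimalSolutions D f ω) = {sol ω}) :
    1 - β ≤ (Measure.pi (fun _ : Fin K => μ)).real
        {ω | StoragePlanning.violation D f μ (sol ω) ≤ ε} ∧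
      (Measure.pi (fun _ : Fin K => μ)).real
        {ω | ε < StoragePlanning.violation D f μ (sol ω)} ≤ β := by
  have hKd : 2 * Fintype.card Site < K :=
    StoragePlanning.lt_of_sum_binomial_lt_one hε (lt_of_le_of_lt hK.1 hβ.2)
  have htail := (StoragePlanning.measureReal_lt_violation_sol_le D f μ hε hKd hrule hsol).trans hK.1
  refine ⟨?_, htail⟩
  -- The two events cover the sample space, which gives the first bound without measurability.
  have hcover := measureReal_union_le (μ := Measure.pi (fun _ : Fin K => μ))
    {ω | StoragePlanning.violation D f μ (sol ω) ≤ ε}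
    {ω | ε < StoragePlanning.violation D f μ (sol ω)}
  have huniv : {ω | StoragePlanning.violation D f μ (sol ω) ≤ ε} ∪
      {ω | ε < StoragePlanning.violation D f μ (sol ω)} = Set.univ :=
    Set.eq_univ_of_forall fun ω => le_or_gt (StoragePlanning.violation D f μ (sol ω)) ε
  rw [huniv, probReal_univ] at hcover
  linarith
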